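/- **Setting.** Write $z^k:=|z|^k e^{ik\arg z}$ with $\arg z\in(-\pi,\pi]$ for $z\in\mathbb C^\times$, $k\in\mathbb R$; let $\mathcal H$ be the upper half-plane, $j(\gamma,\tau):=c\tau+d$ for $\gamma=\begin{pmatrix}a&b\\c&d\end{pmatrix}$, $T:=\begin{pmatrix}1&1\\0&1\end{pmatrix}$, and $d\mathrm v(x+iy):=\frac{dx\,dy}{y^2}$. Let $p\in\mathbb Z_{>0}$ and $k\in\mathbb R$, $k>2$. Let $v:\mathrm{SL}_2(\mathbb Z)\to\{z\in\mathbb C:|z|=1\}$ be a multiplier system of weight $k$, i.e. $\mu(\gamma,\tau):=v(\gamma)j(\gamma,\tau)^k$ satisfies $\mu(\gamma_1\gamma_2,\tau)=\mu(\gamma_1,\gamma_2.\tau)\mu(\gamma_2,\tau)$, with $v(-I_2)=(-1)^{-k}$, and let $\kappa\in[0,1)$ be given by $v(T)=e^{2\pi i\kappa}$. Put $(f|_k\gamma)(\tau):=v(\gamma)^{-1}j(\gamma,\tau)^{-k}f(\gamma.\tau)$ for $\gamma\in\mathrm{SL}_2(\mathbb Z)$ and functions $f$ on $\mathcal H$.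 Let $\Gamma\ni-I_2$ be a subgroup of finite index in $\mathrm{SL}_2(\mathbb Z)$, and let $\rho:\Gamma\to\mathrm{GL}_p(\mathbb C)$ be a representation that is unitary (all $\rho(\gamma)$ are unitary matrices) and normal, i.e. $\rho(-I_2)=I_p$, and for all $\sigma\in\mathrm{SL}_2(\mathbb Z)$ and $L\in\mathbb Z_{>0}$ with $\sigma T^L\sigma^{-1}\in\Gamma$ there is $N\in\mathbb Z_{>0}$ with $(e^{2\pi i\kappa L}\rho(\sigma T^L\sigma^{-1}))^N=I_p$. Put $F|_{k,\rho}\gamma:=\rho(\gamma)^{-1}(F|_k\gamma)$ for $F:\mathcal H\to\mathbb C^p$, $\gamma\in\Gamma$. Let $\mathcal S(k,\rho,\Gamma)$ be the space of holomorphic $F=(F_1,\dots,F_p):\mathcal H\to\mathbb C^p$ such that $F|_k\gamma=\rho(\gamma)F$ for all $\gamma\in\Gamma$ and such that for every $i$ and every $\sigma\in\mathrm{SL}_2(\mathbb Z)$ there are $N\in\mathbb Z_{>0}$ and $a_n\in\mathbb C$ with $(F_i|_k\sigma)(\tau)=\sum_{n\ge1}a_n e^{2\pi i n\tau/N}$ on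 $\mathcal H$. The Petersson inner product on it is $$\langle F,G\rangle_{\mathcal S(k,\rho,\Gamma)}:=\int_{\Gamma\backslash\mathcal H}\langle F(\tau),G(\tau)\rangle_{\mathbb C^p}\,\mathrm{Im}(\tau)^k\,d\mathrm v(\tau),\qquad \langle x,y\rangle_{\mathbb C^p}:=\sum_i x_i\overline{y_i},$$ the integral over $\Gamma\backslash\mathcal H$ being the integral over a fundamental domain for $\Gamma$ in $\mathcal H$. Let $M\in\mathbb Z_{>0}$ be such that the stabilizer of $\infty$ in $\Gamma$ is $\Gamma_\infty=\langle\pm T^M\rangle$, and let $U$ be a unitary $p\times p$ matrix and $m_1,\dots,m_p\in(0,1]\cap\mathbb Q$ such that $\rho(T^M)=e^{-2\pi i\kappa M}U^{-1}\mathrm{diag}(e^{2\pi im_1},\dots,e^{2\pi im_p})U$. **Proposition 5.2.** Let $\nu\in\mathbb Z_{\ge0}$ and $j\in\{1,\dots,p\}$, let $e_j$ be the $j$-th canonical basis vector of $\mathbb C^p$, and let $f(\tau):=e^{2\pi i\frac{\nu+m_j}M\tau}\,U^{-1}e_j$. 1. We have $f|_{k,\rho}\gamma=f$ for all $\gamma\in\Gamma_\infty$,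 so that the terms of the Poincaré series $$\Psi_{k,\rho,\Gamma,\nu,U,j}:=\sum_{\gamma\in\Gamma_\infty\backslash\Gamma}f|_{k,\rho}\gamma$$ are well defined. The series converges absolutely and uniformly on compact sets in $\mathcal H$ and defines an element of $\mathcal S(k,\rho,\Gamma)$. 2. There is a (measurable) fundamental domain for $\Gamma$ in $\mathcal H$. Every $F\in\mathcal S(k,\rho,\Gamma)$ has a Fourier expansion $$(UF)_j(\tau)=\sum_{n=0}^\infty b_n(j)\,e^{2\pi i\frac{n+m_j}M\tau},\qquad\tau\in\mathcal H,$$ and, the Petersson integral being absolutely convergent and computed over any fundamental domain, $$\langle F,\Psi_{k,\rho,\Gamma,\nu,U,j}\rangle_{\mathcal S(k,\rho,\Gamma)}=b_\nu(j)\,\frac{M^k\,\Gamma(k-1)}{(4\pi(\nu+m_j))^{k-1}},$$ where $\Gamma$ on the right-hand side is the gamma function. -/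

import Mathlib

open UpperHalfPlane MeasureTheory
open scoped MatrixGroups Manifold

noncomputable section

namespace VVPoincare

/-- The automorphic factor `μ(γ, τ) = v(γ) j(γ, τ)^k` with `j(γ, τ) = cτ + d`. The real power is the
principal one, `z^k = |z|^k e^{ik arg z}` with `-π < arg z ≤ π`. -/
def autFactor (k : ℝ) (v : SL(2, ℤ) → ℂ) (γ : SL(2, ℤ)) (τ : ℍ) : ℂ :=
  v γ * denom (γ : GL (Fin 2) ℝ) τ ^ (k : ℂ)

/-- `v` is a unitary multiplier system for `SL(2, ℤ)` of weight `k`, subject to the nontriviality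
condition `v(-I) = (-1)^{-k}`. -/
structure IsMultiplierSystem (k : ℝ) (v : SL(2, ℤ) → ℂ) : Prop where
  norm_eq_one : ∀ γ, ‖v γ‖ = 1
  cocycle : ∀ (γ₁ γ₂ : SL(2, ℤ)) (τ : ℍ),
    autFactor k v (γ₁ * γ₂) τ = autFactor k v γ₁ (γ₂ • τ) * autFactor k v γ₂ τ
  nontrivial : v (-1) = (-1 : ℂ) ^ (-(k : ℂ))

/-- The slash action `(f|_k γ)(τ) = v(γ)⁻¹ j(γ, τ)^{-k} f(γ.τ)`, for scalar- or vector-valued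
functions `f` on the upper half-plane. -/
def slash {E : Type*} [AddCommGroup E] [Module ℂ E] (k : ℝ) (v : SL(2, ℤ) → ℂ)
    (f : ℍ → E) (γ : SL(2, ℤ)) : ℍ → E :=
  fun τ => ((v γ)⁻¹ * denom (γ : GL (Fin 2) ℝ) τ ^ (-(k : ℂ))) • f (γ • τ)

/-- `f(τ) = ∑_{n ≥ h} a_n e^{2πi n τ / N}` on the upper half-plane, for some coefficients `a_n` and
some positive integer `N`. -/
def HasFourierExpansionFrom (h : ℤ) (f : ℍ → ℂ) : Prop :=
  ∃ (N : ℕ) (a : ℤ → ℂ), 0 < N ∧ ∀ τ : ℍ,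
    HasSum (fun n : Set.Ici h =>
      a n * Complex.exp (2 * Real.pi * Complex.I * (((n : ℤ) : ℂ) / N) * τ)) (f τ)

/-- The space `𝓕(k)` of holomorphic functions `f` such that every `f|_k σ`, `σ ∈ SL(2, ℤ)`, has a
Fourier expansion with finitely many negative exponents. -/
def scalarForms (k : ℝ) (v : SL(2, ℤ) → ℂ) : Set (ℍ → ℂ) :=
  {f | MDifferentiable 𝓘(ℂ) 𝓘(ℂ) f ∧
    ∀ σ : SL(2, ℤ), ∃ h : ℤ, HasFourierExpansionFrom h (slash k v f σ)}

/-- The space `𝓢(k)`: those `f ∈ 𝓕(k)` for which only positive exponents occur, for every `σ`. -/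
def scalarCuspForms (k : ℝ) (v : SL(2, ℤ) → ℂ) : Set (ℍ → ℂ) :=
  {f | f ∈ scalarForms k v ∧
    ∀ σ : SL(2, ℤ), ∃ h : ℤ, 0 < h ∧ HasFourierExpansionFrom h (slash k v f σ)}

section Vector

variable {p : ℕ} {Γ : Subgroup SL(2, ℤ)}

/-- The space `𝓕(k, ρ, Γ)` of vector-valued modular forms: all components are in `𝓕(k)`, and
`F|_k γ = ρ(γ) F` for `γ ∈ Γ`. -/
def vvForms (k : ℝ) (v : SL(2, ℤ) → ℂ) (ρ : Γ →* GL (Fin p) ℂ) :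
    Set (ℍ → EuclideanSpace ℂ (Fin p)) :=
  {F | (∀ i, (fun τ => F τ i) ∈ scalarForms k v) ∧
    ∀ (γ : Γ) (τ : ℍ), slash k v F γ τ = Matrix.toEuclideanLin (ρ γ).val (F τ)}

/-- The space `𝓢(k, ρ, Γ) = 𝓕(k, ρ, Γ) ∩ 𝓢(k)^p` of cuspidal vector-valued modular forms. -/
def vvCuspForms (k : ℝ) (v : SL(2, ℤ) → ℂ) (ρ : Γ →* GL (Fin p) ℂ) :
    Set (ℍ → EuclideanSpace ℂ (Fin p)) :=
  vvForms k v ρ ∩ {F | ∀ i, (fun τ => F τ i) ∈ scalarCuspForms k v}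

/-- `ρ` is unitary: every `ρ(γ)` is a unitary matrix. -/
def IsUnitaryRep (ρ : Γ →* GL (Fin p) ℂ) : Prop :=
  ∀ γ : Γ, (ρ γ).val ∈ Matrix.unitaryGroup (Fin p) ℂ

/-- `ρ` is a normal representation of `Γ ∋ -I`: `ρ(-I)` is the identity, and for `σ ∈ SL(2, ℤ)` and
`M > 0` with `σ T^M σ⁻¹ ∈ Γ` the matrix `e^{2πiκM} ρ(σ T^M σ⁻¹)` has finite order. -/
def IsNormalRep (κ : ℝ) (ρ : Γ →* GL (Fin p) ℂ) : Prop :=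
  (∀ h : -1 ∈ Γ, ρ ⟨-1, h⟩ = 1) ∧
  ∀ (σ : SL(2, ℤ)) (M : ℕ), 0 < M → ∀ h : σ * ModularGroup.T ^ M * σ⁻¹ ∈ Γ,
    ∃ N : ℕ, 0 < N ∧
      (Complex.exp (2 * Real.pi * Complex.I * κ * M) •
        (ρ ⟨σ * ModularGroup.T ^ M * σ⁻¹, h⟩).val) ^ N = 1

/-- The right action `f|_{k,ρ} γ = ρ(γ)⁻¹ (f|_k γ)` of `Γ`. -/
def slashRep (k : ℝ) (v : SL(2, ℤ) → ℂ) (ρ : Γ →* GL (Fin p) ℂ)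
    (f : ℍ → EuclideanSpace ℂ (Fin p)) (γ : Γ) : ℍ → EuclideanSpace ℂ (Fin p) :=
  fun τ => Matrix.toEuclideanLin ((ρ γ)⁻¹).val (slash k v f γ τ)

/-- The set `Λ \ Γ` of cosets `Λγ`. -/
abbrev RightCosets (Λ : Subgroup Γ) : Type := Quotient (QuotientGroup.rightRel Λ)

/-- The term `f|_{k,ρ} γ` of the Poincaré series that belongs to the coset `Λγ`. It is computed from
one representative `γ`; when `f|_{k,ρ} λ = f` for all `λ ∈ Λ`, the representative does not matter. -/
def poincareTerm (k : ℝ) (v : SL(2, ℤ) → ℂ) (ρ : Γ →* GL (Fin p) ℂ) (Λ : Subgroup Γ)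
    (f : ℍ → EuclideanSpace ℂ (Fin p)) (q : RightCosets Λ) : ℍ → EuclideanSpace ℂ (Fin p) :=
  slashRep k v ρ f q.out

/-- The vector-valued Poincaré series `P_{Λ\Γ,ρ} f = ∑_{γ ∈ Λ\Γ} f|_{k,ρ} γ`. -/
def poincareSeries (k : ℝ) (v : SL(2, ℤ) → ℂ) (ρ : Γ →* GL (Fin p) ℂ) (Λ : Subgroup Γ)
    (f : ℍ → EuclideanSpace ℂ (Fin p)) : ℍ → EuclideanSpace ℂ (Fin p) :=
  fun τ => ∑' q : RightCosets Λ, poincareTerm k v ρ Λ f q τ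

/-- `D` is a fundamental domain for the action of `Γ` on the upper half-plane, with respect to the
invariant measure `dx dy / y²`, which is `volume` on `ℍ`. Since `-I` acts trivially, `Γ` is replaced
by the group of transformations of `ℍ` that it induces. -/
def IsFundDomain (Γ : Subgroup SL(2, ℤ)) (D : Set ℍ) : Prop :=
  IsFundamentalDomain (MulAction.toPermHom Γ ℍ).range D (volume : Measure ℍ)

/-- The integrand `⟨F(τ), G(τ)⟩ Im(τ)^k` of the Petersson inner product, where
`⟨x, y⟩ = ∑ x_i conj(y_i)` is linear in the first variable. -/
def peterssonIntegrand (k : ℝ) (F G : ℍ → EuclideanSpace ℂ (Fin p)) (τ : ℍ) : ℂ :=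
  inner ℂ (G τ) (F τ) * ((τ.im ^ k : ℝ) : ℂ)

/-- The Petersson inner product `⟨F, G⟩ = ∫_{Γ\ℍ} ⟨F(τ), G(τ)⟩ Im(τ)^k dx dy / y²`, the integral
being taken over a fundamental domain `D` for `Γ`. -/
def petersson (k : ℝ) (D : Set ℍ) (F G : ℍ → EuclideanSpace ℂ (Fin p)) : ℂ :=
  ∫ τ in D, peterssonIntegrand k F G τ

/-- The stabilizer `Γ_∞` of the cusp `∞` in `Γ`. -/
def stabInfty (Γ : Subgroup SL(2, ℤ)) : Subgroup Γ :=
  ((MulAction.stabilizer (GL (Fin 2) ℝ) (OnePoint.infty : OnePoint ℝ)).comap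
    (Matrix.SpecialLinearGroup.mapGL ℝ)).subgroupOf Γ

/-- The function `τ ↦ e^{2πi (ν + m_j) τ / M} U⁻¹ e_j`. -/
def expVector (M : ℕ) (m : Fin p → ℚ) (U : Matrix.unitaryGroup (Fin p) ℂ) (ν : ℕ) (j : Fin p) :
    ℍ → EuclideanSpace ℂ (Fin p) :=
  fun τ => Complex.exp (2 * Real.pi * Complex.I * (((ν : ℂ) + (m j : ℂ)) / M) * τ) •
    Matrix.toEuclideanLin (U⁻¹).val (EuclideanSpace.single j (1 : ℂ))

/-- The classical vector-valued Poincaré series `Ψ_{k,ρ,Γ,ν,U,j}`. -/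
def classicalPoincare (k : ℝ) (v : SL(2, ℤ) → ℂ) (ρ : Γ →* GL (Fin p) ℂ) (M : ℕ) (m : Fin p → ℚ)
    (U : Matrix.unitaryGroup (Fin p) ℂ) (ν : ℕ) (j : Fin p) : ℍ → EuclideanSpace ℂ (Fin p) :=
  poincareSeries k v ρ (stabInfty Γ) (expVector M m U ν j)

/-- `(UF)_j(τ) = ∑_{n ≥ 0} b_n e^{2πi (n + m_j) τ / M}` on the upper half-plane. -/
def IsFourierExpansion (M : ℕ) (m : Fin p → ℚ) (U : Matrix.unitaryGroup (Fin p) ℂ) (j : Fin p)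
    (F : ℍ → EuclideanSpace ℂ (Fin p)) (b : ℕ → ℂ) : Prop :=
  ∀ τ : ℍ, HasSum
    (fun n : ℕ => b n * Complex.exp (2 * Real.pi * Complex.I * (((n : ℂ) + (m j : ℂ)) / M) * τ))
    (Matrix.toEuclideanLin U.val (F τ) j)

end Vector

end VVPoincare

end

open UpperHalfPlane MeasureTheory
open scoped MatrixGroups Manifold

noncomputable section

namespace VVPoincare

/-! ### Matrices acting on Euclidean space. -/

section EuclideanMatrix

variable {p : ℕ}

/-! Unitarity of `ρ` and `‖v γ‖ = 1` make `‖F‖ Im^{k/2}` invariant under the action, and this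
controls all growth. A seed of norm at most `1` gives Poincaré terms bounded by `|cτ + d|^{-k}`.
Distinct cosets of the stabilizer of `∞` have distinct bottom rows `(c, d)`, so the Eisenstein sum
over `ℤ²` dominates the series, uniformly on vertical strips, when `k > 2`
(`exists_summable_bound`). Holomorphy follows, and `Γ` merely permutes the cosets.

For cuspidality, finite index and normality of `ρ` make every `F|_k σ` periodic
(`exists_periodic_slash`). Each term decays like `Im^{-k/2}`, so dominated convergence on a strip
makes the sum vanish at `i∞` (`isZeroAtImInfty_slash_poincareSeries`); a periodic holomorphic
function vanishing there has only positive exponents.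

The inner product is computed by unfolding (`unfolding`, `petersson_poincareSeries`): `⟨F, f|_{k,ρ}
γ⟩ Im^k` is `⟨F, f⟩ Im^k` composed with `γ`, so the integral over `Γ\ℍ` becomes one over `0 ≤ Re τ <
M`. There `⟨F, f⟩` sees only the `j`-th coordinate of `UF`, orthogonality of exponentials selects `b
ν`, and the integral over `y` is a Gamma integral. Boundedness of `‖F‖ Im^{k/2}` for cuspidal `F`
supplies absolute convergence. -/

theorem toEuclideanLin_mul_apply (A B : Matrix (Fin p) (Fin p) ℂ) (x : EuclideanSpace ℂ (Fin p)) :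
    Matrix.toEuclideanLin (A * B) x = Matrix.toEuclideanLin A (Matrix.toEuclideanLin B x) := by
  simp [Matrix.toLpLin_apply, Matrix.mulVec_mulVec]

theorem toEuclideanLin_one_apply (x : EuclideanSpace ℂ (Fin p)) :
    Matrix.toEuclideanLin (1 : Matrix (Fin p) (Fin p) ℂ) x = x := by
  simp

theorem toEuclideanLin_inv_apply_self (g : GL (Fin p) ℂ) (x : EuclideanSpace ℂ (Fin p)) :
    Matrix.toEuclideanLin (g⁻¹).val (Matrix.toEuclideanLin g.val x) = x := by
  rw [← toEuclideanLin_mul_apply, ← Units.val_mul, inv_mul_cancel, Units.val_one,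
    toEuclideanLin_one_apply]

theorem toEuclideanLin_self_apply_inv (g : GL (Fin p) ℂ) (x : EuclideanSpace ℂ (Fin p)) :
    Matrix.toEuclideanLin g.val (Matrix.toEuclideanLin (g⁻¹).val x) = x := by
  rw [← toEuclideanLin_mul_apply, ← Units.val_mul, mul_inv_cancel, Units.val_one,
    toEuclideanLin_one_apply]

theorem inner_toEuclideanLin_unitary {A : Matrix (Fin p) (Fin p) ℂ}
    (hA : A ∈ Matrix.unitaryGroup (Fin p) ℂ) (x y : EuclideanSpace ℂ (Fin p)) :
    inner ℂ (Matrix.toEuclideanLin A x) (Matrix.toEuclideanLin A y) = inner ℂ x y := by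
  rw [← LinearMap.adjoint_inner_right, ← Matrix.toEuclideanLin_conjTranspose_eq_adjoint,
    ← toEuclideanLin_mul_apply]
  rw [Matrix.mem_unitaryGroup_iff', Matrix.star_eq_conjTranspose] at hA
  rw [hA, toEuclideanLin_one_apply]

theorem norm_toEuclideanLin_unitary {A : Matrix (Fin p) (Fin p) ℂ}
    (hA : A ∈ Matrix.unitaryGroup (Fin p) ℂ) (x : EuclideanSpace ℂ (Fin p)) :
    ‖Matrix.toEuclideanLin A x‖ = ‖x‖ := by
  rw [@norm_eq_sqrt_re_inner ℂ, @norm_eq_sqrt_re_inner ℂ, inner_toEuclideanLin_unitary hA]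

end EuclideanMatrix

/-! ### The automorphic factor and the weight `k` slash action. -/

section Slash

variable {k : ℝ} {v : SL(2, ℤ) → ℂ}

theorem norm_autFactor (hv : IsMultiplierSystem k v) (γ : SL(2, ℤ)) (τ : ℍ) :
    ‖autFactor k v γ τ‖ = ‖denom (γ : GL (Fin 2) ℝ) τ‖ ^ k := by
  rw [autFactor, norm_mul, hv.norm_eq_one, one_mul, Complex.norm_cpow_real]

theorem autFactor_ne_zero (hv : IsMultiplierSystem k v) (γ : SL(2, ℤ)) (τ : ℍ) :
    autFactor k v γ τ ≠ 0 := by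
  rw [← norm_ne_zero_iff, norm_autFactor hv]
  have := denom_ne_zero (γ : GL (Fin 2) ℝ) τ
  positivity

variable {E : Type*} [AddCommGroup E] [Module ℂ E]

theorem slash_eq (f : ℍ → E) (γ : SL(2, ℤ)) (τ : ℍ) :
    slash k v f γ τ = (autFactor k v γ τ)⁻¹ • f (γ • τ) := by
  rw [slash, autFactor, Complex.cpow_neg, mul_inv]

theorem slash_mul (hv : IsMultiplierSystem k v) (f : ℍ → E) (γ₁ γ₂ : SL(2, ℤ)) :
    slash k v f (γ₁ * γ₂) = slash k v (slash k v f γ₁) γ₂ := by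
  ext τ
  rw [slash_eq, slash_eq, slash_eq, hv.cocycle, mul_smul γ₁ γ₂ τ, mul_inv_rev,
    mul_smul (autFactor k v γ₂ τ)⁻¹]

theorem slash_linearMap {E' : Type*} [AddCommGroup E'] [Module ℂ E'] (L : E →ₗ[ℂ] E') (f : ℍ → E)
    (γ : SL(2, ℤ)) (τ : ℍ) : slash k v (fun τ => L (f τ)) γ τ = L (slash k v f γ τ) := by
  rw [slash_eq, slash_eq, map_smul]

theorem slash_apply_coord {p : ℕ} (F : ℍ → EuclideanSpace ℂ (Fin p)) (γ : SL(2, ℤ)) (τ : ℍ)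
    (i : Fin p) : slash k v (fun τ => F τ i) γ τ = slash k v F γ τ i := by
  simp [slash_eq]

theorem im_smul_rpow (hv : IsMultiplierSystem k v) (γ : SL(2, ℤ)) (τ : ℍ) :
    (γ • τ).im ^ k = τ.im ^ k / ‖autFactor k v γ τ‖ ^ 2 := by
  have h := denom_ne_zero (γ : GL (Fin 2) ℝ) τ
  rw [ModularGroup.im_smul_eq_div_normSq, norm_autFactor hv, Complex.normSq_eq_norm_sq,
    Real.div_rpow τ.im_pos.le (by positivity), ← Real.rpow_natCast, ← Real.rpow_natCast,
    ← Real.rpow_mul (by positivity), ← Real.rpow_mul (by positivity), mul_comm k]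

theorem im_smul_rpow_half (hv : IsMultiplierSystem k v) (γ : SL(2, ℤ)) (τ : ℍ) :
    (γ • τ).im ^ (k / 2) = τ.im ^ (k / 2) / ‖autFactor k v γ τ‖ := by
  have h := im_smul_rpow hv γ τ
  have h1 : ∀ y : ℝ, 0 ≤ y → y ^ k = (y ^ (k / 2)) ^ 2 := fun y hy => by
    rw [← Real.rpow_natCast, ← Real.rpow_mul hy]; norm_num
  rw [h1 _ (γ • τ).im_pos.le, h1 _ τ.im_pos.le, ← div_pow] at h
  have h2 := τ.im_pos
  have h3 := (γ • τ).im_pos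
  exact (sq_eq_sq₀ (by positivity) (by positivity)).mp h

/-- Since `‖v γ‖ = 1`, the factor `|cτ + d|^{-k}` in the slash action is exactly the one by which
`Im^{k/2}` changes under `γ`. -/
theorem norm_slash_mul_im_rpow {E : Type*} [NormedAddCommGroup E] [NormedSpace ℂ E]
    (hv : IsMultiplierSystem k v) (f : ℍ → E) (γ : SL(2, ℤ)) (τ : ℍ) :
    ‖slash k v f γ τ‖ * τ.im ^ (k / 2) = ‖f (γ • τ)‖ * (γ • τ).im ^ (k / 2) := by
  rw [slash_eq, im_smul_rpow_half hv, norm_smul, norm_inv]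
  ring

theorem norm_slash {E : Type*} [NormedAddCommGroup E] [NormedSpace ℂ E]
    (hv : IsMultiplierSystem k v) (f : ℍ → E) (γ : SL(2, ℤ)) (τ : ℍ) :
    ‖slash k v f γ τ‖ = ‖denom (γ : GL (Fin 2) ℝ) τ‖ ^ (-k) * ‖f (γ • τ)‖ := by
  rw [slash_eq, norm_smul, norm_inv, norm_autFactor hv, Real.rpow_neg (norm_nonneg _)]

theorem peterssonIntegrand_smul {p : ℕ} (hv : IsMultiplierSystem k v)
    (F G : ℍ → EuclideanSpace ℂ (Fin p)) (γ : SL(2, ℤ)) (τ : ℍ) :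
    peterssonIntegrand k F G (γ • τ) =
      peterssonIntegrand k (slash k v F γ) (slash k v G γ) τ := by
  rw [peterssonIntegrand, peterssonIntegrand, im_smul_rpow hv, slash_eq, slash_eq,
    inner_smul_left, inner_smul_right]
  have h := autFactor_ne_zero hv γ τ
  push_cast
  rw [← Complex.conj_mul', map_inv₀]
  have h' : (starRingEnd ℂ) (autFactor k v γ τ) ≠ 0 := (map_ne_zero _).mpr h
  field_simp

theorem denom_T_pow (n : ℕ) (τ : ℍ) :
    denom ((ModularGroup.T ^ n : SL(2, ℤ)) : GL (Fin 2) ℝ) τ = 1 := by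
  rw [ModularGroup.denom_apply, ← zpow_natCast, ModularGroup.coe_T_zpow]
  simp

/-- For powers of `T` the denominator is `1`, so the cocycle relation makes `v` multiplicative on
them; at the identity it reads `μ = μ²`, forcing `μ = 1`. -/
theorem autFactor_T_pow (hv : IsMultiplierSystem k v) {κ : ℝ}
    (hvT : v ModularGroup.T = Complex.exp (2 * Real.pi * Complex.I * κ)) (n : ℕ) (τ : ℍ) :
    autFactor k v (ModularGroup.T ^ n) τ = Complex.exp (2 * Real.pi * Complex.I * κ * n) := by
  have key : ∀ (n : ℕ) (τ : ℍ), autFactor k v (ModularGroup.T ^ n) τ = v (ModularGroup.T ^ n) :=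
    fun n τ => by rw [autFactor, denom_T_pow, Complex.one_cpow, mul_one]
  induction n generalizing τ with
  | zero =>
    have h := hv.cocycle 1 1 τ
    rw [mul_one, one_smul, left_eq_mul₀ (autFactor_ne_zero hv _ _)] at h
    simpa using h
  | succ n ih =>
    have h1 := key 1 τ
    rw [pow_one, hvT] at h1
    rw [pow_succ, hv.cocycle, ih, h1, ← Complex.exp_add]
    push_cast
    ring_nf

theorem T_pow_smul (n : ℕ) (τ : ℍ) : (ModularGroup.T ^ n : SL(2, ℤ)) • τ = (n : ℝ) +ᵥ τ := by
  simpa using modular_T_zpow_smul τ n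

theorem slash_T_pow (hv : IsMultiplierSystem k v) {κ : ℝ}
    (hvT : v ModularGroup.T = Complex.exp (2 * Real.pi * Complex.I * κ)) (f : ℍ → E) (n : ℕ)
    (τ : ℍ) : slash k v f (ModularGroup.T ^ n) τ =
      Complex.exp (-(2 * Real.pi * Complex.I * κ * n)) • f ((n : ℝ) +ᵥ τ) := by
  rw [slash_eq, autFactor_T_pow hv hvT, T_pow_smul, Complex.exp_neg]

theorem denom_neg_one (τ : ℍ) : denom ((-1 : SL(2, ℤ)) : GL (Fin 2) ℝ) τ = -1 := by
  rw [ModularGroup.denom_apply]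
  simp

theorem slash_neg_one (hv : IsMultiplierSystem k v) (f : ℍ → E) : slash k v f (-1) = f := by
  ext τ
  rw [slash, hv.nontrivial, denom_neg_one, inv_mul_cancel₀, one_smul, ModularGroup.SL_neg_smul,
    one_smul]
  simp [Complex.cpow_eq_zero_iff]

end Slash

/-! ### The action twisted by `ρ`, and invariance of the Petersson integrand. -/

section SlashRep

variable {p : ℕ} {Γ : Subgroup SL(2, ℤ)} {k : ℝ} {v : SL(2, ℤ) → ℂ} {ρ : Γ →* GL (Fin p) ℂ}

theorem slashRep_mul (hv : IsMultiplierSystem k v) (f : ℍ → EuclideanSpace ℂ (Fin p)) (γ₁ γ₂ : Γ) :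
    slashRep k v ρ f (γ₁ * γ₂) = slashRep k v ρ (slashRep k v ρ f γ₁) γ₂ := by
  ext1 τ
  rw [slashRep, slashRep, show slashRep k v ρ f γ₁ = fun τ => Matrix.toEuclideanLin ((ρ γ₁)⁻¹).val
    (slash k v f γ₁ τ) from rfl, slash_linearMap, map_mul, mul_inv_rev, Units.val_mul,
    toEuclideanLin_mul_apply, Subgroup.coe_mul, slash_mul hv]

theorem slashRep_one (hv : IsMultiplierSystem k v) (f : ℍ → EuclideanSpace ℂ (Fin p)) :
    slashRep k v ρ f 1 = f := by
  ext1 τ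
  have h := hv.cocycle 1 1 τ
  rw [mul_one, one_smul, left_eq_mul₀ (autFactor_ne_zero hv _ _)] at h
  rw [slashRep, map_one, inv_one, Units.val_one, toEuclideanLin_one_apply, Subgroup.coe_one,
    slash_eq, h, one_smul, inv_one, one_smul]

theorem IsUnitaryRep.inv_mem (hρ : IsUnitaryRep ρ) (γ : Γ) :
    ((ρ γ)⁻¹).val ∈ Matrix.unitaryGroup (Fin p) ℂ := by
  rw [← map_inv]
  exact hρ _

theorem norm_slashRep (hρ : IsUnitaryRep ρ) (f : ℍ → EuclideanSpace ℂ (Fin p)) (γ : Γ) (τ : ℍ) :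
    ‖slashRep k v ρ f γ τ‖ = ‖slash k v f γ τ‖ :=
  norm_toEuclideanLin_unitary (hρ.inv_mem γ) _

/-- The action of `Γ` on vector-valued functions, as a linear map in the value of the function. -/
theorem slashRep_eq_smul (f : ℍ → EuclideanSpace ℂ (Fin p)) (γ : Γ) (τ : ℍ) :
    slashRep k v ρ f γ τ =
      (autFactor k v γ τ)⁻¹ • Matrix.toEuclideanLin ((ρ γ)⁻¹).val (f ((γ : SL(2, ℤ)) • τ)) := by
  rw [slashRep, slash_eq, map_smul]

/-- Invariance under `|_{k,ρ}` amounts to `F|_k γ = ρ(γ) F`. -/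
theorem slashRep_eq_self_iff {F : ℍ → EuclideanSpace ℂ (Fin p)} {γ : Γ} :
    slashRep k v ρ F γ = F ↔ ∀ τ, slash k v F γ τ = Matrix.toEuclideanLin (ρ γ).val (F τ) := by
  refine ⟨fun h τ => ?_, fun h => funext fun τ => ?_⟩
  · conv_rhs => rw [← h]
    rw [slashRep, toEuclideanLin_self_apply_inv]
  · rw [slashRep, h, toEuclideanLin_inv_apply_self]

/-- If `F|_k γ = ρ(γ) F`, then `⟨F, f⟩ Im^k` composed with `γ` is `⟨F, f|_{k,ρ} γ⟩ Im^k`. -/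
theorem peterssonIntegrand_smul_of_invariant (hv : IsMultiplierSystem k v) (hρ : IsUnitaryRep ρ)
    {F : ℍ → EuclideanSpace ℂ (Fin p)} {γ : Γ} (hF : slashRep k v ρ F γ = F)
    (f : ℍ → EuclideanSpace ℂ (Fin p)) (τ : ℍ) :
    peterssonIntegrand k F f ((γ : SL(2, ℤ)) • τ) =
      peterssonIntegrand k F (slashRep k v ρ f γ) τ := by
  rw [peterssonIntegrand_smul hv]
  conv_rhs => rw [← hF]
  rw [peterssonIntegrand, peterssonIntegrand, slashRep, slashRep,
    inner_toEuclideanLin_unitary (hρ.inv_mem γ)]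

theorem smul_im_rpow_norm_of_invariant (hv : IsMultiplierSystem k v) (hρ : IsUnitaryRep ρ)
    {F : ℍ → EuclideanSpace ℂ (Fin p)} {γ : Γ} (hF : slashRep k v ρ F γ = F) (τ : ℍ) :
    ‖F ((γ : SL(2, ℤ)) • τ)‖ * ((γ : SL(2, ℤ)) • τ).im ^ (k / 2) = ‖F τ‖ * τ.im ^ (k / 2) := by
  rw [← norm_slash_mul_im_rpow hv, ← norm_slashRep hρ, hF]

end SlashRep

/-! ### Fourier expansions and decay at `i∞`. -/

section QExpansion

theorem periodic_comp_ofComplex {E : Type*} {f : ℍ → E} {h : ℝ} (hf : ∀ τ, f (h +ᵥ τ) = f τ) :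
    Function.Periodic (f ∘ ofComplex) h := by
  intro w
  -- Off the upper half-plane `ofComplex` is constant, so periodicity there is automatic.
  by_cases! hw : 0 < w.im
  · have h' : 0 < (w + h).im := by simp [hw]
    simp only [Function.comp_apply, ofComplex_apply_of_im_pos h', ofComplex_apply_of_im_pos hw]
    rw [← hf ⟨w, hw⟩]
    congr 1
    ext
    simp [add_comm]
  · have h' : (w + h).im ≤ 0 := by simpa using hw
    simp [ofComplex_apply_of_im_nonpos h', ofComplex_apply_of_im_nonpos hw]

/-- A periodic holomorphic function that vanishes at `i∞` has a Fourier expansion with positive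
exponents only. -/
theorem exists_hasSum_of_periodic_of_isZeroAtImInfty {f : ℍ → ℂ} {N : ℕ} (hN : 0 < N)
    (hper : ∀ τ, f ((N : ℝ) +ᵥ τ) = f τ) (hf : MDifferentiable 𝓘(ℂ) 𝓘(ℂ) f)
    (h0 : IsZeroAtImInfty f) :
    ∃ a : ℕ → ℂ, ∀ τ : ℍ, HasSum (fun n : ℕ =>
      a n * Complex.exp (2 * Real.pi * Complex.I * (((n : ℂ) + 1) / N) * τ)) (f τ) := by
  have hN' : (0 : ℝ) < N := by exact_mod_cast hN
  have hp := periodic_comp_ofComplex hper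
  have hb := h0.isBoundedAtImInfty
  refine ⟨fun n => (qExpansion (N : ℝ) f).coeff (n + 1), fun τ => ?_⟩
  have h := hasSum_qExpansion hN' hp hf hb τ
  have hc : (qExpansion (N : ℝ) f).coeff 0 = 0 := by
    rw [qExpansion_coeff_zero hN' (analyticAt_cuspFunction_zero hN' hp hf hb) hp,
      h0.valueAtInfty_eq_zero]
  rw [← hasSum_nat_add_iff' 1] at h
  simp only [Finset.range_one, Finset.sum_singleton, hc, zero_smul, sub_zero] at h
  refine h.congr_fun fun n => ?_
  rw [smul_eq_mul, Function.Periodic.qParam, ← Complex.exp_nat_mul]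
  congr 2
  push_cast
  ring

theorem hasFourierExpansionFrom_one_of_periodic {f : ℍ → ℂ} {N : ℕ} (hN : 0 < N)
    (hper : ∀ τ, f ((N : ℝ) +ᵥ τ) = f τ) (hf : MDifferentiable 𝓘(ℂ) 𝓘(ℂ) f)
    (h0 : IsZeroAtImInfty f) : HasFourierExpansionFrom 1 f := by
  obtain ⟨a, ha⟩ := exists_hasSum_of_periodic_of_isZeroAtImInfty hN hper hf h0
  let e : ℕ ≃ Set.Ici (1 : ℤ) :=
    { toFun := fun n => ⟨n + 1, by simp⟩
      invFun := fun n => ((n : ℤ) - 1).toNat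
      left_inv := fun n => by simp
      right_inv := fun n => by
        have := n.2
        rw [Set.mem_Ici] at this
        ext
        simp only
        omega }
  refine ⟨N, fun n => a (n - 1).toNat, hN, fun τ => ?_⟩
  rw [← e.hasSum_iff]
  refine (ha τ).congr_fun fun n => ?_
  simp [e]

theorem norm_exp_two_pi_I_mul (r : ℝ) (τ : ℍ) :
    ‖Complex.exp (2 * Real.pi * Complex.I * r * τ)‖ = Real.exp (-(2 * Real.pi * r * τ.im)) := by
  rw [Complex.norm_exp]
  congr 1
  simp

/-- A function with a Fourier expansion with positive exponents decays exponentially at `i∞`. -/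
theorem HasFourierExpansionFrom.exists_exp_bound {f : ℍ → ℂ} {h : ℤ} (hh : 0 < h)
    (hf : HasFourierExpansionFrom h f) :
    ∃ c > 0, ∃ C, ∀ τ : ℍ, 1 ≤ τ.im → ‖f τ‖ ≤ C * Real.exp (-(c * τ.im)) := by
  obtain ⟨N, a, hN, ha⟩ := hf
  have hN' : (0 : ℝ) < N := by exact_mod_cast hN
  have hnorm : ∀ (n : ℤ) (τ : ℍ),
      ‖a n * Complex.exp (2 * Real.pi * Complex.I * ((n : ℂ) / N) * τ)‖ =
        ‖a n‖ * Real.exp (-(2 * Real.pi * (n / N) * τ.im)) := fun n τ => by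
    rw [norm_mul, ← norm_exp_two_pi_I_mul]
    push_cast
    rfl
  -- Absolute convergence at the single point `i` dominates the series on `Im τ ≥ 1`: with `y = Im
  -- τ`, `(n - 1)(y - 1) ≥ 0` gives `-ny ≤ -n + 1 - y`, whence the rate `2π/N` and the extra factor
  -- `e^{2π/N}`.
  have hs := (ha I).summable.norm
  simp only [hnorm, I_im, mul_one] at hs
  refine ⟨2 * Real.pi / N, by positivity, (∑' n : Set.Ici h, ‖a n‖ *
    Real.exp (-(2 * Real.pi * ((n : ℤ) / N)))) * Real.exp (2 * Real.pi / N), fun τ hτ => ?_⟩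
  rw [mul_assoc, ← Real.exp_add]
  refine (ha τ).norm_le_of_bounded (hs.hasSum.mul_right _) fun n => ?_
  rw [hnorm, mul_assoc ‖a n‖, ← Real.exp_add]
  gcongr
  have h1 : (1 : ℝ) ≤ (n : ℤ) := by
    have := n.2
    rw [Set.mem_Ici] at this
    exact_mod_cast (show (1 : ℤ) ≤ n by omega)
  have h2 : 0 ≤ 2 * Real.pi / N * (((n : ℤ) - 1) * (τ.im - 1)) := by
    have : 0 ≤ (((n : ℤ) : ℝ) - 1) * (τ.im - 1) := mul_nonneg (by linarith) (by linarith)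
    positivity
  have h3 : 2 * Real.pi * (((n : ℤ) : ℝ) / N) * τ.im = 2 * Real.pi / N * ((n : ℤ) * τ.im) := by ring
  have h4 : 2 * Real.pi * (((n : ℤ) : ℝ) / N) = 2 * Real.pi / N * (n : ℤ) := by ring
  rw [h3, h4]
  linarith

end QExpansion

/-! ### Holomorphy of slashed functions. -/

section Holomorphic

variable {k : ℝ} {v : SL(2, ℤ) → ℂ}

theorem mdifferentiable_denom_cpow (γ : SL(2, ℤ)) (s : ℂ) :
    MDifferentiable 𝓘(ℂ) 𝓘(ℂ) (fun τ : ℍ => denom (γ : GL (Fin 2) ℝ) τ ^ s) := by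
  -- If `c = 0` the base is a constant, possibly on the branch cut; if `c ≠ 0` then `cτ + d` is
  -- never real, so the principal power is holomorphic there.
  by_cases hc : γ 1 0 = 0
  · have : (fun τ : ℍ => denom (γ : GL (Fin 2) ℝ) τ ^ s) = fun _ => ((γ 1 1 : ℤ) : ℂ) ^ s := by
      ext τ
      rw [ModularGroup.denom_apply, hc]
      simp
    rw [this]
    exact mdifferentiable_const
  · intro τ
    have hs : denom (γ : GL (Fin 2) ℝ) τ ∈ Complex.slitPlane := by
      refine Complex.mem_slitPlane_iff.mpr (Or.inr ?_)
      rw [ModularGroup.denom_apply]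
      have := τ.im_ne_zero
      simpa using ⟨hc, this⟩
    exact ((differentiableAt_id.cpow_const hs).mdifferentiableAt (f := fun z : ℂ => z ^ s)).comp τ
      (mdifferentiable_denom _ τ)

theorem mdifferentiable_slash {f : ℍ → ℂ} (hf : MDifferentiable 𝓘(ℂ) 𝓘(ℂ) f) (γ : SL(2, ℤ)) :
    MDifferentiable 𝓘(ℂ) 𝓘(ℂ) (slash k v f γ) := by
  have h1 : MDifferentiable 𝓘(ℂ) 𝓘(ℂ) (fun τ : ℍ => γ • τ) :=
    mdifferentiable_smul (g := (γ : GL (Fin 2) ℝ)) (by simp)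
  exact (mdifferentiable_const.mul (mdifferentiable_denom_cpow γ (-(k : ℂ)))).mul (hf.comp h1)

theorem continuous_of_mdifferentiable_coord {p : ℕ} {F : ℍ → EuclideanSpace ℂ (Fin p)}
    (hF : ∀ i, MDifferentiable 𝓘(ℂ) 𝓘(ℂ) (fun τ => F τ i)) : Continuous F :=
  (PiLp.continuous_toLp 2 _).comp (continuous_pi fun i => (hF i).continuous)

theorem mdifferentiable_toEuclideanLin_coord {p : ℕ} {F : ℍ → EuclideanSpace ℂ (Fin p)}
    (hF : ∀ i, MDifferentiable 𝓘(ℂ) 𝓘(ℂ) (fun τ => F τ i)) (A : Matrix (Fin p) (Fin p) ℂ)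
    (i : Fin p) : MDifferentiable 𝓘(ℂ) 𝓘(ℂ) (fun τ => Matrix.toEuclideanLin A (F τ) i) := by
  have : (fun τ => Matrix.toEuclideanLin A (F τ) i) = fun τ => ∑ l, A i l * F τ l := by
    ext τ
    simp [Matrix.toLpLin_apply, Matrix.mulVec, dotProduct]
  rw [this, UpperHalfPlane.mdifferentiable_iff]
  have hs : (fun τ => ∑ l, A i l * F τ l) ∘ ofComplex =
      fun z => ∑ l, A i l * ((fun τ => F τ l) ∘ ofComplex) z := rfl
  rw [hs]
  exact DifferentiableOn.fun_sum fun l _ => (UpperHalfPlane.mdifferentiable_iff.mp (hF l)).const_mul _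

end Holomorphic

/-! ### Invariance of the seed under the stabilizer of `∞`. -/

section StabInfty

variable {p : ℕ} {Γ : Subgroup SL(2, ℤ)} {k : ℝ} {v : SL(2, ℤ) → ℂ} {ρ : Γ →* GL (Fin p) ℂ}

theorem mem_stabInfty_iff {γ : Γ} : γ ∈ stabInfty Γ ↔ (γ : SL(2, ℤ)) 1 0 = 0 := by
  rw [stabInfty, Subgroup.mem_subgroupOf, Subgroup.mem_comap, MulAction.mem_stabilizer_iff,
    OnePoint.smul_infty_eq_self_iff]
  simp

/-- The elements of `Γ` that fix `f` under `|_{k,ρ}`. -/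
def slashRepStabilizer (hv : IsMultiplierSystem k v) (ρ : Γ →* GL (Fin p) ℂ)
    (f : ℍ → EuclideanSpace ℂ (Fin p)) : Subgroup Γ where
  carrier := {γ | slashRep k v ρ f γ = f}
  mul_mem' {a b} ha hb := by
    rw [Set.mem_ofPred_eq] at ha hb ⊢
    rw [slashRep_mul hv, ha, hb]
  one_mem' := slashRep_one hv f
  inv_mem' {a} ha := by
    rw [Set.mem_ofPred_eq] at ha ⊢
    conv_lhs => rw [← ha]
    rw [← slashRep_mul hv, mul_inv_cancel, slashRep_one hv]

theorem mem_slashRepStabilizer_iff {hv : IsMultiplierSystem k v}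
    {f : ℍ → EuclideanSpace ℂ (Fin p)} {γ : Γ} :
    γ ∈ slashRepStabilizer hv ρ f ↔ slashRep k v ρ f γ = f := Iff.rfl

theorem slashRep_neg_one (hv : IsMultiplierSystem k v) (h : -1 ∈ Γ) (hρ : ρ ⟨-1, h⟩ = 1)
    (f : ℍ → EuclideanSpace ℂ (Fin p)) : slashRep k v ρ f ⟨-1, h⟩ = f := by
  ext1 τ
  rw [slashRep, hρ, inv_one, Units.val_one, toEuclideanLin_one_apply]
  exact congrFun (slash_neg_one hv f) τ

/-- A function that is fixed by `T ^ M` is fixed by `Γ_∞ = ⟨± T ^ M⟩`. -/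
theorem slashRep_eq_self_of_mem_stabInfty (hv : IsMultiplierSystem k v) (hneg : -1 ∈ Γ)
    (hρ : ρ ⟨-1, hneg⟩ = 1) {M : ℕ}
    (hstab : (stabInfty Γ).map Γ.subtype =
      Subgroup.closure {ModularGroup.T ^ M, -(ModularGroup.T ^ M)})
    (hTM : ModularGroup.T ^ M ∈ Γ) {f : ℍ → EuclideanSpace ℂ (Fin p)}
    (hf : slashRep k v ρ f ⟨ModularGroup.T ^ M, hTM⟩ = f) {γ : Γ} (hγ : γ ∈ stabInfty Γ) :
    slashRep k v ρ f γ = f := by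
  have h1 : (γ : SL(2, ℤ)) ∈ (stabInfty Γ).map Γ.subtype := ⟨γ, hγ, rfl⟩
  have h2 : Subgroup.closure {ModularGroup.T ^ M, -(ModularGroup.T ^ M)} ≤
      (slashRepStabilizer hv ρ f).map Γ.subtype := by
    have hT := mem_slashRepStabilizer_iff (hv := hv).mpr hf
    have hN := mem_slashRepStabilizer_iff (hv := hv).mpr (slashRep_neg_one hv hneg hρ f)
    rw [Subgroup.closure_le]
    rintro g (rfl | rfl)
    · exact ⟨_, hT, rfl⟩
    · exact ⟨_, mul_mem hN hT, by simp⟩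
  rw [hstab] at h1
  obtain ⟨γ', h3, h4⟩ := h2 h1
  rw [Subgroup.subtype_apply, SetLike.coe_eq_coe] at h4
  rw [h4] at h3
  exact mem_slashRepStabilizer_iff.mp h3

theorem toEuclideanLin_conj_diagonal_apply (U : Matrix.unitaryGroup (Fin p) ℂ) (d : Fin p → ℂ)
    (j : Fin p) :
    Matrix.toEuclideanLin ((U⁻¹).val * Matrix.diagonal d * U.val)
      (Matrix.toEuclideanLin (U⁻¹).val (EuclideanSpace.single j (1 : ℂ))) =
    d j • Matrix.toEuclideanLin (U⁻¹).val (EuclideanSpace.single j (1 : ℂ)) := by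
  have h : U.val * (U⁻¹).val = 1 := by
    rw [← Submonoid.coe_mul, mul_inv_cancel, Submonoid.coe_one]
  rw [← toEuclideanLin_mul_apply, mul_assoc, h, mul_one, toEuclideanLin_mul_apply, ← map_smul]
  congr 1
  ext i
  simp [Matrix.toLpLin_apply]

theorem slashRep_expVector_T_pow (hv : IsMultiplierSystem k v) {κ : ℝ}
    (hvT : v ModularGroup.T = Complex.exp (2 * Real.pi * Complex.I * κ)) {M : ℕ} (hM : 0 < M)
    (hTM : ModularGroup.T ^ M ∈ Γ) {U : Matrix.unitaryGroup (Fin p) ℂ} {m : Fin p → ℚ}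
    (hU : (ρ ⟨ModularGroup.T ^ M, hTM⟩).val =
      Complex.exp (-(2 * Real.pi * Complex.I * κ * M)) •
        ((U⁻¹).val *
          Matrix.diagonal (fun i => Complex.exp (2 * Real.pi * Complex.I * (m i : ℂ))) * U.val))
    (ν : ℕ) (j : Fin p) :
    slashRep k v ρ (expVector M m U ν j) ⟨ModularGroup.T ^ M, hTM⟩ = expVector M m U ν j := by
  rw [slashRep_eq_self_iff]
  intro τ
  rw [slash_T_pow hv hvT, hU, expVector, expVector, map_smul, map_smul, LinearMap.smul_apply,
    toEuclideanLin_conj_diagonal_apply, smul_smul, smul_smul, smul_smul]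
  congr 1
  rw [← Complex.exp_add, ← Complex.exp_add, ← Complex.exp_add, Complex.exp_eq_exp_iff_exists_int]
  -- Translation by `M` produces `e^{2πi(ν + m_j)}`; the eigenvalue of `ρ(T^M)` absorbs `e^{2πi
  -- m_j}` and its scalar cancels `v(T^M)`, leaving `e^{2πiν} = 1`.
  refine ⟨ν, ?_⟩
  have hM' : (M : ℂ) ≠ 0 := by exact_mod_cast hM.ne'
  rw [coe_vadd]
  push_cast
  field_simp
  ring

end StabInfty

/-! ### Convergence, invariance and cuspidality of the Poincaré series. -/

section Cosets

variable {p : ℕ} {Γ : Subgroup SL(2, ℤ)} {k : ℝ} {v : SL(2, ℤ) → ℂ} {ρ : Γ →* GL (Fin p) ℂ}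

theorem exists_mul_out_eq {G : Type*} [Group G] (Λ : Subgroup G) (γ : G) :
    ∃ l ∈ Λ, γ = l * (Quotient.mk (QuotientGroup.rightRel Λ) γ).out := by
  have h : (QuotientGroup.rightRel Λ) (Quotient.mk (QuotientGroup.rightRel Λ) γ).out γ :=
    Quotient.mk_out γ
  rw [QuotientGroup.rightRel_apply] at h
  exact ⟨_, h, by group⟩

theorem mk_eq_mk_of_mul_inv_mem {G : Type*} [Group G] {Λ : Subgroup G} {a b : G}
    (h : b * a⁻¹ ∈ Λ) :
    Quotient.mk (QuotientGroup.rightRel Λ) a = Quotient.mk (QuotientGroup.rightRel Λ) b :=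
  Quotient.sound (QuotientGroup.rightRel_apply.mpr h)

/-- Right multiplication on right cosets. -/
def rightCosetsMulRight {Λ : Subgroup Γ} (γ : Γ) : RightCosets Λ ≃ RightCosets Λ where
  toFun := Quotient.map (· * γ) fun a b h => by
    have h' := QuotientGroup.rightRel_apply.mp h
    exact QuotientGroup.rightRel_apply.mpr (by simpa [mul_assoc] using h')
  invFun := Quotient.map (· * γ⁻¹) fun a b h => by
    have h' := QuotientGroup.rightRel_apply.mp h
    exact QuotientGroup.rightRel_apply.mpr (by simpa [mul_assoc] using h')
  left_inv q := by
    induction q using Quotient.inductionOn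
    simp
  right_inv q := by
    induction q using Quotient.inductionOn
    simp

theorem rightCosetsMulRight_eq {Λ : Subgroup Γ} (γ : Γ) (q : RightCosets Λ) :
    rightCosetsMulRight γ q = Quotient.mk _ (q.out * γ) := by
  conv_lhs => rw [← q.out_eq]
  rfl

theorem poincareTerm_mk (hv : IsMultiplierSystem k v) {Λ : Subgroup Γ}
    {f : ℍ → EuclideanSpace ℂ (Fin p)} (hf : ∀ l ∈ Λ, slashRep k v ρ f l = f) (γ : Γ) :
    poincareTerm k v ρ Λ f (Quotient.mk _ γ) = slashRep k v ρ f γ := by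
  obtain ⟨l, hl, h⟩ := exists_mul_out_eq Λ γ
  conv_rhs => rw [h, slashRep_mul hv, hf l hl]
  rfl

theorem slashRep_poincareTerm (hv : IsMultiplierSystem k v) {Λ : Subgroup Γ}
    {f : ℍ → EuclideanSpace ℂ (Fin p)} (hf : ∀ l ∈ Λ, slashRep k v ρ f l = f) (q : RightCosets Λ)
    (γ : Γ) : slashRep k v ρ (poincareTerm k v ρ Λ f q) γ =
      poincareTerm k v ρ Λ f (rightCosetsMulRight γ q) := by
  rw [rightCosetsMulRight_eq, poincareTerm_mk hv hf, slashRep_mul hv]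
  rfl

/-- The lower left entry of `b a⁻¹` is, up to sign, the determinant of the two bottom rows. -/
theorem mul_inv_apply_one_zero {a b : SL(2, ℤ)} (h0 : a.val 1 0 = b.val 1 0)
    (h1 : a.val 1 1 = b.val 1 1) : (b * a⁻¹) 1 0 = 0 := by
  have : (b * a⁻¹) 1 0 = b.val 1 0 * a.val 1 1 - b.val 1 1 * a.val 1 0 := by
    rw [Matrix.SpecialLinearGroup.SL2_inv_expl]
    change (b.val * !![a.val 1 1, -a.val 0 1; -a.val 1 0, a.val 0 0]) 1 0 = _
    simp [Matrix.mul_apply, Fin.sum_univ_two, sub_eq_add_neg]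
  rw [this, h0, h1]
  ring

/-- Right cosets of the stabilizer of `∞` are determined by bottom rows. -/
theorem injective_bottom_row (σ : SL(2, ℤ)) :
    Function.Injective fun q : RightCosets (stabInfty Γ) => ((q.out : SL(2, ℤ)) * σ).val 1 := by
  intro q q' h
  have h0 := congrFun h 0
  have h1 := congrFun h 1
  rw [← q.out_eq, ← q'.out_eq]
  refine mk_eq_mk_of_mul_inv_mem (mem_stabInfty_iff.mpr ?_)
  have h2 : ((q'.out * q.out⁻¹ : Γ) : SL(2, ℤ)) =
      ((q'.out : SL(2, ℤ)) * σ) * ((q.out : SL(2, ℤ)) * σ)⁻¹ := by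
    simp
  rw [h2]
  exact mul_inv_apply_one_zero h0 h1

theorem slash_one (hv : IsMultiplierSystem k v) {E : Type*} [AddCommGroup E] [Module ℂ E]
    (f : ℍ → E) : slash k v f 1 = f := by
  ext τ
  have h := hv.cocycle 1 1 τ
  rw [mul_one, one_smul, left_eq_mul₀ (autFactor_ne_zero hv _ _)] at h
  rw [slash_eq, h, one_smul, inv_one, one_smul]

theorem slash_poincareTerm (hv : IsMultiplierSystem k v) {Λ : Subgroup Γ}
    (f : ℍ → EuclideanSpace ℂ (Fin p)) (q : RightCosets Λ) (σ : SL(2, ℤ)) (τ : ℍ) :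
    slash k v (poincareTerm k v ρ Λ f q) σ τ =
      Matrix.toEuclideanLin ((ρ q.out)⁻¹).val (slash k v f ((q.out : SL(2, ℤ)) * σ) τ) := by
  rw [slash_mul hv, ← slash_linearMap]
  rfl

/-- The terms are bounded by `|cτ + d|^{-k}`, where `(c, d)` is the bottom row of `γσ`. Different
cosets give different rows, so the lattice sum of `‖(c, d)‖^{-k}` is a majorant, finite for `k > 2`.
Allowing arbitrary `σ` serves the behaviour at all cusps. -/
theorem exists_summable_bound (hk : 2 < k) (hv : IsMultiplierSystem k v) (hρ : IsUnitaryRep ρ)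
    {f : ℍ → EuclideanSpace ℂ (Fin p)} (hf : ∀ τ, ‖f τ‖ ≤ 1) (σ : SL(2, ℤ)) (A : ℝ) {B : ℝ}
    (hB : 0 < B) : ∃ u : RightCosets (stabInfty Γ) → ℝ, Summable u ∧
      ∀ q, ∀ τ ∈ verticalStrip A B,
        ‖slash k v (poincareTerm k v ρ (stabInfty Γ) f q) σ τ‖ ≤ u q := by
  refine ⟨fun q => EisensteinSeries.r ⟨⟨A, B⟩, hB⟩ ^ (-k) *
    ‖((q.out : SL(2, ℤ)) * σ).val 1‖ ^ (-k), ?_, fun q τ hτ => ?_⟩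
  · exact ((EisensteinSeries.summable_one_div_norm_rpow hk).comp_injective
      (injective_bottom_row σ)).mul_left _
  · rw [slash_poincareTerm hv, norm_toEuclideanLin_unitary (hρ.inv_mem _), norm_slash hv]
    have h := EisensteinSeries.summand_bound_of_mem_verticalStrip (k := k) (by linarith)
      (((q.out : SL(2, ℤ)) * σ).val 1) hB hτ
    refine (mul_le_of_le_one_right (by positivity) (hf _)).trans ?_
    rw [ModularGroup.denom_apply]
    exact h

theorem exists_summable_bound_poincareTerm (hk : 2 < k) (hv : IsMultiplierSystem k v)
    (hρ : IsUnitaryRep ρ) {f : ℍ → EuclideanSpace ℂ (Fin p)} (hf : ∀ τ, ‖f τ‖ ≤ 1) (A : ℝ) {B : ℝ}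
    (hB : 0 < B) : ∃ u : RightCosets (stabInfty Γ) → ℝ, Summable u ∧
      ∀ q, ∀ τ ∈ verticalStrip A B, ‖poincareTerm k v ρ (stabInfty Γ) f q τ‖ ≤ u q := by
  simpa only [slash_one hv] using exists_summable_bound hk hv hρ hf 1 A hB

theorem mem_verticalStrip_self (τ : ℍ) : τ ∈ verticalStrip |τ.re| τ.im := ⟨le_rfl, le_rfl⟩

theorem summable_poincareTerm (hk : 2 < k) (hv : IsMultiplierSystem k v)
    (hρ : IsUnitaryRep ρ) {f : ℍ → EuclideanSpace ℂ (Fin p)} (hf : ∀ τ, ‖f τ‖ ≤ 1) (τ : ℍ) :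
    Summable fun q => poincareTerm k v ρ (stabInfty Γ) f q τ := by
  obtain ⟨u, hu, h⟩ := exists_summable_bound_poincareTerm hk hv hρ hf |τ.re| τ.im_pos
  exact Summable.of_norm_bounded hu fun q => h q τ (mem_verticalStrip_self τ)

theorem hasSumUniformlyOn_poincareTerm (hk : 2 < k) (hv : IsMultiplierSystem k v)
    (hρ : IsUnitaryRep ρ) {f : ℍ → EuclideanSpace ℂ (Fin p)} (hf : ∀ τ, ‖f τ‖ ≤ 1) {K : Set ℍ}
    (hK : IsCompact K) :
    HasSumUniformlyOn (fun q τ => ‖poincareTerm k v ρ (stabInfty Γ) f q τ‖)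
      (fun τ => ∑' q, ‖poincareTerm k v ρ (stabInfty Γ) f q τ‖) K ∧
    HasSumUniformlyOn (poincareTerm k v ρ (stabInfty Γ) f)
      (poincareSeries k v ρ (stabInfty Γ) f) K := by
  obtain ⟨A, B, hB, hKs⟩ := subset_verticalStrip_of_isCompact hK
  obtain ⟨u, hu, h⟩ := exists_summable_bound_poincareTerm hk hv hρ hf A hB
  refine ⟨HasSumUniformlyOn.of_norm_le_summable hu fun q τ hτ => ?_,
    HasSumUniformlyOn.of_norm_le_summable hu fun q τ hτ => h q τ (hKs hτ)⟩
  rw [norm_norm]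
  exact h q τ (hKs hτ)

theorem slash_poincareSeries (σ : SL(2, ℤ)) {Λ : Subgroup Γ} (f : ℍ → EuclideanSpace ℂ (Fin p))
    (τ : ℍ) : slash k v (poincareSeries k v ρ Λ f) σ τ =
      ∑' q, slash k v (poincareTerm k v ρ Λ f q) σ τ := by
  simp only [slash_eq]
  -- Over a field a scalar leaves `tsum` without any summability assumption.
  rw [tsum_const_smul'']
  rfl

/-- The Poincaré series is invariant under `|_{k,ρ}`. -/
theorem slashRep_poincareSeries (hk : 2 < k) (hv : IsMultiplierSystem k v) (hρ : IsUnitaryRep ρ)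
    {f : ℍ → EuclideanSpace ℂ (Fin p)} (hf : ∀ τ, ‖f τ‖ ≤ 1)
    (hinv : ∀ l ∈ stabInfty Γ, slashRep k v ρ f l = f) (γ : Γ) :
    slashRep k v ρ (poincareSeries k v ρ (stabInfty Γ) f) γ =
      poincareSeries k v ρ (stabInfty Γ) f := by
  ext1 τ
  -- At a fixed `τ` the action is a continuous linear map of the value at `γτ`, so it passes through
  -- the sum; what remains is a permutation of the cosets.
  obtain ⟨L, hL⟩ : ∃ L : EuclideanSpace ℂ (Fin p) →L[ℂ] EuclideanSpace ℂ (Fin p),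
      ∀ F, slashRep k v ρ F γ τ = L (F ((γ : SL(2, ℤ)) • τ)) :=
    ⟨(autFactor k v γ τ)⁻¹ •
      LinearMap.toContinuousLinearMap (Matrix.toEuclideanLin ((ρ γ)⁻¹).val), fun F => by
      rw [slashRep_eq_smul]
      rfl⟩
  have h := (summable_poincareTerm (Γ := Γ) (ρ := ρ) hk hv hρ hf ((γ : SL(2, ℤ)) • τ)).hasSum
  have h1 := h.mapL L
  simp only [← hL, slashRep_poincareTerm hv hinv] at h1
  have h2 := (Equiv.hasSum_iff (f := fun q => poincareTerm k v ρ (stabInfty Γ) f q τ)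
    (rightCosetsMulRight γ)).mpr (summable_poincareTerm hk hv hρ hf τ).hasSum
  rw [hL]
  exact h1.unique h2

theorem mdifferentiable_poincareTerm {Λ : Subgroup Γ} {f : ℍ → EuclideanSpace ℂ (Fin p)}
    (hf : ∀ i, MDifferentiable 𝓘(ℂ) 𝓘(ℂ) (fun τ => f τ i)) (q : RightCosets Λ) (i : Fin p) :
    MDifferentiable 𝓘(ℂ) 𝓘(ℂ) (fun τ => poincareTerm k v ρ Λ f q τ i) := by
  refine mdifferentiable_toEuclideanLin_coord (fun i => ?_) _ i
  have h := mdifferentiable_slash (k := k) (v := v) (hf i) (q.out : SL(2, ℤ))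
  convert! h using 2 with τ

theorem mdifferentiable_poincareSeries (hk : 2 < k) (hv : IsMultiplierSystem k v)
    (hρ : IsUnitaryRep ρ) {f : ℍ → EuclideanSpace ℂ (Fin p)} (hf : ∀ τ, ‖f τ‖ ≤ 1)
    (hfd : ∀ i, MDifferentiable 𝓘(ℂ) 𝓘(ℂ) (fun τ => f τ i)) (i : Fin p) :
    MDifferentiable 𝓘(ℂ) 𝓘(ℂ) (fun τ => poincareSeries k v ρ (stabInfty Γ) f τ i) := by
  have hcoord : (fun τ => poincareSeries k v ρ (stabInfty Γ) f τ i) =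
      fun τ => ∑' q, poincareTerm k v ρ (stabInfty Γ) f q τ i := by
    ext τ
    exact (EuclideanSpace.proj (𝕜 := ℂ) i).map_tsum (summable_poincareTerm hk hv hρ hf τ)
  rw [hcoord]
  intro τ
  have hτ := τ.im_pos
  -- The margins `|Re τ| + 1` and `Im τ / 2` leave room for an open neighbourhood of `τ` inside the
  -- strip, as the Weierstrass theorem requires.
  obtain ⟨u, hu, h⟩ := exists_summable_bound_poincareTerm hk hv hρ hf (|τ.re| + 1) (half_pos hτ)
  rw [UpperHalfPlane.mdifferentiableAt_iff]
  let V : Set ℂ := {z | |z.re| < |τ.re| + 1 ∧ τ.im / 2 < z.im}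
  have hV : IsOpen V :=
    (isOpen_lt Complex.continuous_re.abs continuous_const).inter
      (isOpen_lt continuous_const Complex.continuous_im)
  have hτV : (τ : ℂ) ∈ V := ⟨by simp, by simpa using hτ⟩
  have hVim : ∀ z ∈ V, 0 < z.im := fun z hz => (half_pos hτ).trans hz.2
  have hd : DifferentiableOn ℂ
      (fun z => ∑' q, poincareTerm k v ρ (stabInfty Γ) f q (ofComplex z) i) V := by
    refine Complex.differentiableOn_tsum_of_summable_norm hu (fun q => ?_) hV fun q z hz => ?_
    · exact (UpperHalfPlane.mdifferentiable_iff.mp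
        (mdifferentiable_poincareTerm (k := k) (v := v) (ρ := ρ) hfd q i)).mono hVim
    · refine (PiLp.norm_apply_le _ i).trans (h q _ ?_)
      rw [ofComplex_apply_of_im_pos (hVim z hz)]
      exact ⟨hz.1.le, hz.2.le⟩
  exact hd.differentiableAt (hV.mem_nhds hτV)

/-- If `F|_k γ = ρ(γ) F` for `γ ∈ Γ`, with `ρ` normal, then every `F|_k σ` is periodic. -/
theorem exists_periodic_slash (hv : IsMultiplierSystem k v) {κ : ℝ}
    (hvT : v ModularGroup.T = Complex.exp (2 * Real.pi * Complex.I * κ)) (hfin : Γ.FiniteIndex)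
    (hnormal : IsNormalRep κ ρ) {F : ℍ → EuclideanSpace ℂ (Fin p)}
    (hF : ∀ (γ : Γ) (τ : ℍ), slash k v F γ τ = Matrix.toEuclideanLin (ρ γ).val (F τ))
    (σ : SL(2, ℤ)) :
    ∃ N : ℕ, 0 < N ∧ ∀ τ, slash k v F σ ((N : ℝ) +ᵥ τ) = slash k v F σ τ := by
  -- Finite index puts `σ T^L σ⁻¹` in `Γ` for some `L`. Translation by `L` then acts on the values
  -- through a matrix `A`, and normality gives `A ^ N = 1`, so `L * N` is a period.
  obtain ⟨L, hL, -, hLΓ⟩ :=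
    Subgroup.exists_pow_mem_of_index_ne_zero hfin.index_ne_zero (σ * ModularGroup.T * σ⁻¹)
  rw [conj_pow] at hLΓ
  obtain ⟨N, hN, hpow⟩ := hnormal.2 σ L hL hLΓ
  set A := Complex.exp (2 * Real.pi * Complex.I * κ * L) •
    (ρ ⟨σ * ModularGroup.T ^ L * σ⁻¹, hLΓ⟩).val with hA
  have hstep : ∀ τ, slash k v F σ ((L : ℝ) +ᵥ τ) = Matrix.toEuclideanLin A (slash k v F σ τ) := by
    intro τ
    have h1 := slash_T_pow hv hvT (slash k v F σ) L τ
    have h2 : slash k v F (σ * ModularGroup.T ^ L) τ = Matrix.toEuclideanLin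
        (ρ ⟨σ * ModularGroup.T ^ L * σ⁻¹, hLΓ⟩).val (slash k v F σ τ) := by
      have h3 : slash k v F (σ * ModularGroup.T ^ L) =
          slash k v F (σ * ModularGroup.T ^ L * σ⁻¹ * σ) := by rw [inv_mul_cancel_right]
      rw [h3, slash_mul hv, ← slash_linearMap]
      congr 1
      ext1 τ
      exact hF ⟨_, hLΓ⟩ τ
    rw [← slash_mul hv, h2, Complex.exp_neg, eq_inv_smul_iff₀ (Complex.exp_ne_zero _)] at h1
    rw [← h1, hA, map_smul, LinearMap.smul_apply]
  have hiter : ∀ (n : ℕ) τ, slash k v F σ (((L * n : ℕ) : ℝ) +ᵥ τ) =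
      Matrix.toEuclideanLin (A ^ n) (slash k v F σ τ) := by
    intro n
    induction n with
    | zero => intro τ; simp
    | succ n ih =>
      intro τ
      rw [pow_succ, toEuclideanLin_mul_apply, ← hstep, ← ih, ← add_vadd]
      congr 2
      push_cast
      ring
  refine ⟨L * N, Nat.mul_pos hL hN, fun τ => ?_⟩
  rw [hiter, hpow, toEuclideanLin_one_apply]

/-- The majorant of the series is available only on vertical strips; translation by multiples of `N`
moves every point into one without changing its imaginary part. -/
theorem isZeroAtImInfty_of_periodic {E : Type*} [NormedAddCommGroup E] {G : ℍ → E} {N : ℕ}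
    (hN : 0 < N) (hper : ∀ τ, G ((N : ℝ) +ᵥ τ) = G τ)
    (hG : Filter.Tendsto G (atImInfty ⊓ Filter.principal (verticalStrip N 1)) (nhds 0)) :
    IsZeroAtImInfty G := by
  rw [isZeroAtImInfty_iff]
  intro ε hε
  have h := hG.eventually (Metric.closedBall_mem_nhds (0 : E) hε)
  rw [Filter.eventually_inf_principal] at h
  obtain ⟨A, hA⟩ := (atImInfty_mem _).mp h
  refine ⟨max A 1, fun z hz => ?_⟩
  obtain ⟨n, hn⟩ := ModularGroup_T_zpow_mem_verticalStrip z hN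
  rw [modular_T_zpow_smul] at hn
  have hz' : ((((N * n : ℤ) : ℝ) +ᵥ z : ℍ)).im = z.im := vadd_im _ _
  have h1 := hA ((((N * n : ℤ) : ℝ) +ᵥ z : ℍ)) (by rw [hz']; exact (le_max_left _ _).trans hz)
    ⟨hn.1, by rw [hz']; exact (le_max_right _ _).trans hz⟩
  have h2 : G (((N * n : ℤ) : ℝ) +ᵥ z) = G z := by
    have h3 := (periodic_comp_ofComplex hper).int_mul n (z : ℂ)
    rw [Function.comp_apply, Function.comp_apply, ofComplex_apply] at h3
    rw [← h3, ← ofComplex_apply (((N * n : ℤ) : ℝ) +ᵥ z), coe_vadd]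
    congr 2
    push_cast
    ring
  rw [h2] at h1
  simpa using h1

/-- By invariance of `‖f‖ Im^{k/2}`, every single term is at most `C Im^{-k/2}` and tends to zero;
the summable majorant on the strip lets the limit pass through the sum. -/
theorem isZeroAtImInfty_slash_poincareSeries (hk : 2 < k) (hv : IsMultiplierSystem k v)
    (hρ : IsUnitaryRep ρ) {f : ℍ → EuclideanSpace ℂ (Fin p)} (hf : ∀ τ, ‖f τ‖ ≤ 1) {C : ℝ}
    (hC : ∀ τ, ‖f τ‖ * τ.im ^ (k / 2) ≤ C) {σ : SL(2, ℤ)} {N : ℕ} (hN : 0 < N)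
    (hper : ∀ τ, slash k v (poincareSeries k v ρ (stabInfty Γ) f) σ ((N : ℝ) +ᵥ τ) =
      slash k v (poincareSeries k v ρ (stabInfty Γ) f) σ τ) :
    IsZeroAtImInfty (slash k v (poincareSeries k v ρ (stabInfty Γ) f) σ) := by
  refine isZeroAtImInfty_of_periodic hN hper ?_
  obtain ⟨u, hu, h⟩ := exists_summable_bound hk hv hρ hf σ N zero_lt_one
  have hterm : ∀ q, Filter.Tendsto (fun τ => slash k v (poincareTerm k v ρ (stabInfty Γ) f q) σ τ)
      (atImInfty ⊓ Filter.principal (verticalStrip N 1)) (nhds 0) := by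
    intro q
    refine (squeeze_zero_norm (a := fun τ : ℍ => C * τ.im ^ (-(k / 2))) (fun τ => ?_) ?_).mono_left
      (inf_le_left : _ ≤ atImInfty)
    · rw [slash_poincareTerm hv, norm_toEuclideanLin_unitary (hρ.inv_mem _),
        Real.rpow_neg τ.im_pos.le, ← div_eq_mul_inv,
        le_div_iff₀ (Real.rpow_pos_of_pos τ.im_pos _), norm_slash_mul_im_rpow hv]
      exact hC _
    · rw [← mul_zero C]
      exact ((tendsto_rpow_neg_atTop (by linarith)).comp Filter.tendsto_comap).const_mul C
  have hlim := tendsto_tsum_of_dominated_convergence hu hterm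
    (Filter.eventually_inf_principal.mpr (Filter.Eventually.of_forall fun τ hτ q => h q τ hτ))
  rw [tsum_zero] at hlim
  exact hlim.congr fun τ => (slash_poincareSeries σ f τ).symm

/-- A Poincaré series whose seed is bounded, also after multiplication with `Im^{k/2}`, is a
cuspidal form. -/
theorem poincareSeries_mem_vvCuspForms (hk : 2 < k) (hv : IsMultiplierSystem k v) {κ : ℝ}
    (hvT : v ModularGroup.T = Complex.exp (2 * Real.pi * Complex.I * κ)) (hfin : Γ.FiniteIndex)
    (hρ : IsUnitaryRep ρ) (hnormal : IsNormalRep κ ρ) {f : ℍ → EuclideanSpace ℂ (Fin p)}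
    (hf : ∀ τ, ‖f τ‖ ≤ 1) {C : ℝ} (hC : ∀ τ, ‖f τ‖ * τ.im ^ (k / 2) ≤ C)
    (hfd : ∀ i, MDifferentiable 𝓘(ℂ) 𝓘(ℂ) (fun τ => f τ i))
    (hinv : ∀ l ∈ stabInfty Γ, slashRep k v ρ f l = f) :
    poincareSeries k v ρ (stabInfty Γ) f ∈ vvCuspForms k v ρ := by
  have htrans : ∀ (γ : Γ) (τ : ℍ), slash k v (poincareSeries k v ρ (stabInfty Γ) f) γ τ =
      Matrix.toEuclideanLin (ρ γ).val (poincareSeries k v ρ (stabInfty Γ) f τ) := fun γ =>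
    slashRep_eq_self_iff.mp (slashRep_poincareSeries hk hv hρ hf hinv γ)
  have hd := mdifferentiable_poincareSeries (Γ := Γ) (ρ := ρ) hk hv hρ hf hfd
  have hexp : ∀ i (σ : SL(2, ℤ)), HasFourierExpansionFrom 1
      (slash k v (fun τ => poincareSeries k v ρ (stabInfty Γ) f τ i) σ) := by
    intro i σ
    obtain ⟨N, hN, hper⟩ := exists_periodic_slash hv hvT hfin hnormal htrans σ
    have hzero := isZeroAtImInfty_slash_poincareSeries hk hv hρ hf hC hN hper
    refine hasFourierExpansionFrom_one_of_periodic hN (fun τ => ?_) (mdifferentiable_slash (hd i) σ)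
      ?_
    · rw [slash_apply_coord, slash_apply_coord, hper]
    · refine squeeze_zero_norm (fun τ => ?_) (tendsto_zero_iff_norm_tendsto_zero.mp hzero)
      rw [slash_apply_coord]
      exact PiLp.norm_apply_le _ i
  have hforms : ∀ i, (fun τ => poincareSeries k v ρ (stabInfty Γ) f τ i) ∈ scalarForms k v :=
    fun i => ⟨hd i, fun σ => ⟨1, hexp i σ⟩⟩
  exact ⟨⟨hforms, htrans⟩, fun i => ⟨hforms i, fun σ => ⟨1, one_pos, hexp i σ⟩⟩⟩

end Cosets

/-! ### Fundamental domains of subgroups and abstract unfolding. -/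

section FundamentalDomains

open Pointwise

theorem countable_of_le_range {A X : Type*} [Group A] [MulAction A X] [Countable A]
    {H : Subgroup (Equiv.Perm X)}
    (hH : H ≤ (MulAction.toPermHom A X).range) : Countable H :=
  have : Countable (MulAction.toPermHom A X).range :=
    (MulAction.toPermHom A X).rangeRestrict_surjective.countable
  (Subgroup.inclusion_injective hH).countable

variable {A X : Type*} [Group A] [MulAction A X] [MeasurableSpace X] {μ : Measure X}

theorem measurableConstSMul_of_le_range [MeasurableConstSMul A X] {H : Subgroup (Equiv.Perm X)}
    (hH : H ≤ (MulAction.toPermHom A X).range) : MeasurableConstSMul H X where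
  measurable_const_smul g := by
    obtain ⟨a, ha⟩ := hH g.2
    have : (fun x : X => g • x) = fun x => a • x := by
      ext x
      change g.1 x = _
      rw [← ha]
      rfl
    change Measurable fun x : X => g • x
    rw [this]
    exact measurable_const_smul a

theorem smulInvariantMeasure_of_le_range [SMulInvariantMeasure A X μ]
    {H : Subgroup (Equiv.Perm X)} (hH : H ≤ (MulAction.toPermHom A X).range) :
    SMulInvariantMeasure H X μ where
  measure_preimage_smul g s hs := by
    obtain ⟨a, ha⟩ := hH g.2
    have : (fun x : X => g • x) = fun x => a • x := by
      ext x
      change g.1 x = _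
      rw [← ha]
      rfl
    rw [this]
    exact SMulInvariantMeasure.measure_preimage_smul a hs

/-- Translates of a fundamental domain by elements of different cosets of a subgroup that contains
the kernel of the action. -/
theorem aedisjoint_smul_of_toPermHom_ne {D : Set X}
    (hD : IsFundamentalDomain (MulAction.toPermHom A X).range D μ) {a b : A}
    (hab : MulAction.toPermHom A X a ≠ MulAction.toPermHom A X b) :
    AEDisjoint μ (a • D) (b • D) :=
  hD.aedisjoint (i := ⟨MulAction.toPermHom A X a, a, rfl⟩)
    (j := ⟨MulAction.toPermHom A X b, b, rfl⟩) fun h => hab (congrArg Subtype.val h)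

theorem pairwise_aedisjoint_out_smul {Λ : Subgroup A} (hker : (MulAction.toPermHom A X).ker ≤ Λ)
    {D : Set X} (hD : IsFundamentalDomain (MulAction.toPermHom A X).range D μ) :
    Pairwise (Function.onFun (AEDisjoint μ)
      fun q : Quotient (QuotientGroup.rightRel Λ) => q.out • D) := by
  intro q q' hq
  refine aedisjoint_smul_of_toPermHom_ne hD fun h => hq ?_
  rw [← q.out_eq, ← q'.out_eq]
  refine mk_eq_mk_of_mul_inv_mem (hker ?_)
  rw [MonoidHom.mem_ker, map_mul, map_inv, h, mul_inv_cancel]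

/-- A fundamental domain for a subgroup, as a union of translates of one for the whole group. -/
theorem isFundamentalDomain_iUnion_out_smul [Countable A] [MeasurableConstSMul A X]
    [SMulInvariantMeasure A X μ] {Λ : Subgroup A} (hker : (MulAction.toPermHom A X).ker ≤ Λ)
    {D : Set X} (hD : IsFundamentalDomain (MulAction.toPermHom A X).range D μ) :
    IsFundamentalDomain (Λ.map (MulAction.toPermHom A X))
      (⋃ q : Quotient (QuotientGroup.rightRel Λ), q.out • D) μ where
  nullMeasurableSet := NullMeasurableSet.iUnion fun q => hD.nullMeasurableSet.smul q.out
  ae_covers := by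
    filter_upwards [hD.ae_covers] with x hx
    obtain ⟨⟨_, a, rfl⟩, hx⟩ := hx
    -- Since `a • x ∈ D` and `a⁻¹ = l r` with `r` the chosen representative, `l⁻¹ • x = r • (a • x)`
    -- lies in the translate `r • D`.
    obtain ⟨l, hl, h⟩ := exists_mul_out_eq Λ a⁻¹
    refine ⟨⟨MulAction.toPermHom A X l⁻¹, l⁻¹, inv_mem hl, rfl⟩, Set.mem_iUnion.mpr
      ⟨Quotient.mk _ a⁻¹, Set.mem_smul_set.mpr ⟨a • x, hx, ?_⟩⟩⟩
    change _ = l⁻¹ • x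
    rw [← inv_mul_eq_iff_eq_mul] at h
    rw [← h, smul_smul, inv_mul_cancel_right]
  aedisjoint := by
    rintro ⟨_, l, hl, rfl⟩ ⟨_, l', hl', rfl⟩ hne
    have hsmul : ∀ (c : A) (hc : c ∈ Λ), (⟨MulAction.toPermHom A X c, c, hc, rfl⟩ :
        Λ.map (MulAction.toPermHom A X)) • (⋃ q : Quotient (QuotientGroup.rightRel Λ), q.out • D) =
        ⋃ q : Quotient (QuotientGroup.rightRel Λ), (c * q.out) • D := by
      intro c hc
      change c • (⋃ q : Quotient (QuotientGroup.rightRel Λ), q.out • D) = _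
      simp only [Set.smul_set_iUnion, smul_smul]
    change AEDisjoint μ (_ • _) (_ • _)
    rw [hsmul l hl, hsmul l' hl', AEDisjoint.iUnion_left_iff]
    intro q
    rw [AEDisjoint.iUnion_right_iff]
    intro q'
    refine aedisjoint_smul_of_toPermHom_ne hD fun h => hne ?_
    -- Elements inducing the same transformation differ by the kernel, which lies in `Λ`; hence the
    -- two representatives define one coset.
    have hqq : q = q' := by
      rw [← q.out_eq, ← q'.out_eq]
      refine mk_eq_mk_of_mul_inv_mem ?_
      have h1 : (l' * q'.out) * (l * q.out)⁻¹ ∈ Λ := by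
        refine hker ?_
        rw [MonoidHom.mem_ker, map_mul, map_inv, h, mul_inv_cancel]
      have h2 : q'.out * q.out⁻¹ = l'⁻¹ * ((l' * q'.out) * (l * q.out)⁻¹) * l := by group
      rw [h2]
      exact mul_mem (mul_mem (inv_mem hl') h1) hl
    subst hqq
    rw [map_mul, map_mul, mul_left_inj] at h
    exact Subtype.ext h

/-- Unfolding: the integral of a `Λ`-invariant function over a fundamental domain for `Λ` as a sum
over `Λ \ A` of integrals over a fundamental domain for `A`. -/
theorem unfolding [Countable A] [MeasurableConstSMul A X] [SMulInvariantMeasure A X μ]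
    {E : Type*} [NormedAddCommGroup E] [NormedSpace ℝ E]
    {Λ : Subgroup A} (hker : (MulAction.toPermHom A X).ker ≤ Λ) {D S : Set X}
    (hD : IsFundamentalDomain (MulAction.toPermHom A X).range D μ)
    (hS : IsFundamentalDomain (Λ.map (MulAction.toPermHom A X)) S μ)
    {g : X → E} (hg : ∀ l ∈ Λ, ∀ x, g (l • x) = g x) (hint : IntegrableOn g S μ) :
    (∀ q : Quotient (QuotientGroup.rightRel Λ), IntegrableOn (fun x => g (q.out • x)) D μ) ∧
    HasSum (fun q : Quotient (QuotientGroup.rightRel Λ) => ∫ x in D, g (q.out • x) ∂μ)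
      (∫ x in S, g x ∂μ) := by
  have hle : Λ.map (MulAction.toPermHom A X) ≤ (MulAction.toPermHom A X).range :=
    Subgroup.map_le_range _ _
  have := measurableConstSMul_of_le_range hle
  have := smulInvariantMeasure_of_le_range (μ := μ) hle
  have := countable_of_le_range hle
  have hU := isFundamentalDomain_iUnion_out_smul hker hD
  have hg' : ∀ (l : Λ.map (MulAction.toPermHom A X)) (x : X), g (l • x) = g x := by
    rintro ⟨_, l, hl, rfl⟩ x
    exact hg l hl x
  -- For `Λ`-invariant functions the choice of fundamental domain is immaterial, so `S` may be
  -- exchanged for the union of translates of `D`.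
  have hintU := (hU.integrableOn_iff hS hg').mpr hint
  have hemb : ∀ a : A, MeasurableEmbedding (fun x : X => a • x) := measurableEmbedding_const_smul
  have hmp : ∀ a : A, MeasurePreserving (fun x : X => a • x) μ μ := fun a =>
    measurePreserving_smul a μ
  refine ⟨fun q => ?_, ?_⟩
  · have h1 := hintU.mono_set (Set.subset_iUnion (fun q : Quotient (QuotientGroup.rightRel Λ) =>
      q.out • D) q)
    have h2 := (hmp q.out).integrableOn_image (hemb q.out) (f := g) (s := D)
    exact h2.mp h1
  · rw [← hU.setIntegral_eq hS hg']
    have hnull : ∀ q : Quotient (QuotientGroup.rightRel Λ), NullMeasurableSet (q.out • D) μ :=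
      fun q => hD.nullMeasurableSet.smul q.out
    have h := hasSum_integral_iUnion_ae (s := fun q : Quotient (QuotientGroup.rightRel Λ) =>
      q.out • D) hnull (pairwise_aedisjoint_out_smul hker hD) hintU
    refine h.congr_fun fun q => ?_
    have h1 := (hmp q.out).setIntegral_preimage_emb (hemb q.out) g (q.out • D)
    rwa [show (fun x : X => q.out • x) ⁻¹' (q.out • D) = D from
      Set.preimage_image_eq _ (hemb q.out).injective] at h1

end FundamentalDomains

/-! ### Fundamental domains for `Γ` and for the stabilizer of `∞`. -/

section ModularFundamentalDomains

open Pointwise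

/-- It suffices to test the interior point `2i` of the standard fundamental domain. -/
theorem eq_one_or_neg_one_of_forall_smul_eq {γ : SL(2, ℤ)} (h : ∀ τ : ℍ, γ • τ = τ) :
    γ = 1 ∨ γ = -1 := by
  have hz : (⟨2 * Complex.I, by simp⟩ : ℍ) ∈ ModularGroup.fdo := by
    constructor <;> norm_num [Complex.normSq_apply, UpperHalfPlane.re]
  exact ModularGroup.eq_one_or_neg_one_of_mem_fdo_mem_fdo hz (by rwa [h])

instance countable_SL : Countable SL(2, ℤ) :=
  Function.Injective.countable (f := fun (γ : SL(2, ℤ)) (i j : Fin 2) => γ i j) fun _ _ h =>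
    Subtype.ext (funext fun i => funext fun j => congrFun (congrFun h i) j)

instance measurableConstSMul_SL : MeasurableConstSMul SL(2, ℤ) ℍ where
  measurable_const_smul γ :=
    (continuous_const_smul (γ : GL (Fin 2) ℝ) : Continuous fun _ : ℍ => _).measurable

instance smulInvariantMeasure_SL : SMulInvariantMeasure SL(2, ℤ) ℍ volume where
  measure_preimage_smul γ _ hs :=
    SMulInvariantMeasure.measure_preimage_smul (γ : GL (Fin 2) ℝ) hs

theorem volume_eq_zero_of_image_coe {s : Set ℍ} (hs : volume (UpperHalfPlane.coe '' s) = 0) :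
    volume s = 0 := by
  rw [volume_eq_lintegral]
  exact setLIntegral_measure_zero _ _ hs

theorem volume_re_eq (c : ℝ) : volume {z : ℂ | z.re = c} = 0 := by
  have h : {z : ℂ | z.re = c} = Complex.measurableEquivRealProd ⁻¹' ({c} ×ˢ Set.univ) := by
    ext z
    simp [Complex.measurableEquivRealProd_apply]
  rw [h, Complex.volume_preserving_equiv_real_prod.measure_preimage_equiv, Measure.volume_eq_prod,
    Measure.prod_prod, Real.volume_singleton, zero_mul]

theorem volume_fd_diff_fdo : volume (ModularGroup.fd \ ModularGroup.fdo) = 0 := by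
  refine volume_eq_zero_of_image_coe (measure_mono_null (t := Metric.sphere (0 : ℂ) 1 ∪
    ({z : ℂ | z.re = 1 / 2} ∪ {z : ℂ | z.re = -(1 / 2)})) ?_ ?_)
  · rintro _ ⟨τ, ⟨⟨h1, h2⟩, h3⟩, rfl⟩
    by_cases h4 : 1 < Complex.normSq τ
    · right
      have h5 : ¬ |τ.re| < 1 / 2 := fun h => h3 ⟨h4, h⟩
      rcases (abs_eq (by norm_num)).mp (le_antisymm h2 (not_lt.mp h5)) with h | h
      · exact Or.inl h
      · exact Or.inr h
    · left
      have h5 : Complex.normSq τ = 1 := le_antisymm (not_lt.mp h4) h1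
      rw [mem_sphere_zero_iff_norm, Complex.norm_def, h5, Real.sqrt_one]
  · simp only [measure_union_null_iff, volume_re_eq, and_self, and_true]
    exact Measure.addHaar_sphere _ _ _

theorem isFundamentalDomain_fdo :
    IsFundamentalDomain (MulAction.toPermHom SL(2, ℤ) ℍ).range ModularGroup.fdo
      (volume : Measure ℍ) where
  nullMeasurableSet := ModularGroup.isOpen_fdo.measurableSet.nullMeasurableSet
  ae_covers := by
    -- The group is countable and the boundary is null, so almost no point has a translate on the
    -- boundary.
    have h : ∀ᵐ τ : ℍ, ∀ γ : SL(2, ℤ), γ • τ ∉ ModularGroup.fd \ ModularGroup.fdo := by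
      rw [ae_all_iff]
      intro γ
      exact (measurePreserving_smul γ volume).quasiMeasurePreserving.ae
        (compl_mem_ae_iff.mpr volume_fd_diff_fdo)
    filter_upwards [h] with τ hτ
    obtain ⟨γ, hγ⟩ := ModularGroup.exists_smul_mem_fd τ
    exact ⟨⟨_, γ, rfl⟩, by_contra fun h' => hτ γ ⟨hγ, h'⟩⟩
  aedisjoint := by
    rintro ⟨_, a, rfl⟩ ⟨_, b, rfl⟩ hne
    refine Disjoint.aedisjoint (Set.disjoint_left.mpr ?_)
    rintro _ ⟨x, hx, rfl⟩ ⟨y, hy, hxy⟩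
    have h1 : b • y = a • x := hxy
    have h2 : (a⁻¹ * b) • y = x := by rw [mul_smul, h1, inv_smul_smul]
    refine hne (Subtype.ext (Equiv.ext fun z => ?_))
    change a • z = b • z
    rcases ModularGroup.eq_one_or_neg_one_of_mem_fdo_mem_fdo hy (h2.symm ▸ hx) with h | h
    · rw [inv_mul_eq_one.mp h]
    · rw [inv_mul_eq_iff_eq_mul.mp h, mul_neg, mul_one, ModularGroup.SL_neg_smul]

variable {Γ : Subgroup SL(2, ℤ)}

/-- The union of translates of the standard domain over `Γ \ SL(2, ℤ)` works because `-1 ∈ Γ` puts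
the whole kernel `{±1}` in `Γ`. -/
theorem exists_isFundDomain (hneg : -1 ∈ Γ) : ∃ D, IsFundDomain Γ D := by
  have hker : (MulAction.toPermHom SL(2, ℤ) ℍ).ker ≤ Γ := by
    intro γ hγ
    rcases eq_one_or_neg_one_of_forall_smul_eq fun τ =>
      congrArg (fun e : Equiv.Perm ℍ => e τ) (MonoidHom.mem_ker.mp hγ) with rfl | rfl
    · exact one_mem _
    · exact hneg
  have h := isFundamentalDomain_iUnion_out_smul hker isFundamentalDomain_fdo
  have heq : Γ.map (MulAction.toPermHom SL(2, ℤ) ℍ) = (MulAction.toPermHom Γ ℍ).range := by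
    ext e
    constructor
    · rintro ⟨γ, hγ, rfl⟩
      exact ⟨⟨γ, hγ⟩, rfl⟩
    · rintro ⟨γ, rfl⟩
      exact ⟨γ.1, γ.2, rfl⟩
  rw [heq] at h
  exact ⟨_, h⟩

theorem ker_toPermHom_le_stabInfty : (MulAction.toPermHom Γ ℍ).ker ≤ stabInfty Γ := by
  intro γ hγ
  rw [mem_stabInfty_iff]
  rcases eq_one_or_neg_one_of_forall_smul_eq (γ := (γ : SL(2, ℤ))) fun τ =>
    congrArg (fun e : Equiv.Perm ℍ => e τ) (MonoidHom.mem_ker.mp hγ) with h | h <;>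
  simp [h]

/-- `Γ_∞ = ⟨± T ^ M⟩` acts by translations by multiples of `M`. -/
theorem exists_smul_eq_vadd_of_mem_stabInfty {M : ℕ}
    (hstab : (stabInfty Γ).map Γ.subtype =
      Subgroup.closure {ModularGroup.T ^ M, -(ModularGroup.T ^ M)})
    {γ : Γ} (hγ : γ ∈ stabInfty Γ) :
    ∃ n : ℤ, ∀ τ : ℍ, (γ : SL(2, ℤ)) • τ = ((n • (M : ℝ) : ℝ)) +ᵥ τ := by
  have h1 : (γ : SL(2, ℤ)) ∈ (stabInfty Γ).map Γ.subtype := ⟨γ, hγ, rfl⟩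
  rw [hstab] at h1
  generalize (γ : SL(2, ℤ)) = g at h1
  induction h1 using Subgroup.closure_induction with
  | mem g hg =>
    refine ⟨1, fun τ => ?_⟩
    rw [one_smul]
    rcases hg with rfl | rfl
    · exact T_pow_smul M τ
    · rw [ModularGroup.SL_neg_smul, T_pow_smul]
  | one => exact ⟨0, fun τ => by simp⟩
  | mul a b _ _ ha hb =>
    obtain ⟨n, hn⟩ := ha
    obtain ⟨l, hl⟩ := hb
    exact ⟨n + l, fun τ => by rw [mul_smul, hl, hn, add_smul, add_vadd]⟩
  | inv a _ ha =>
    obtain ⟨n, hn⟩ := ha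
    refine ⟨-n, fun τ => ?_⟩
    rw [inv_smul_eq_iff, hn, ← add_vadd, ← add_smul, add_neg_cancel, zero_smul, zero_vadd]

/-- The vertical strip `0 ≤ Re τ < M`. -/
def strip (M : ℕ) : Set ℍ := {τ | τ.re ∈ Set.Ico (0 : ℝ) M}

theorem mem_strip_iff {M : ℕ} {τ : ℍ} : τ ∈ strip M ↔ τ.re ∈ Set.Ico (0 : ℝ) M := Iff.rfl

theorem measurableSet_strip (M : ℕ) : MeasurableSet (strip M) :=
  continuous_re.measurable measurableSet_Ico

theorem isFundamentalDomain_strip {M : ℕ} (hM : 0 < M)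
    (hstab : (stabInfty Γ).map Γ.subtype =
      Subgroup.closure {ModularGroup.T ^ M, -(ModularGroup.T ^ M)})
    (hTM : ModularGroup.T ^ M ∈ Γ) :
    IsFundamentalDomain ((stabInfty Γ).map (MulAction.toPermHom Γ ℍ)) (strip M)
      (volume : Measure ℍ) := by
  have hM' : (0 : ℝ) < M := by exact_mod_cast hM
  refine IsFundamentalDomain.mk' (measurableSet_strip M).nullMeasurableSet fun τ => ?_
  obtain ⟨n, hn, huniq⟩ := existsUnique_add_zsmul_mem_Ico hM' τ.re 0
  rw [zero_add] at hn
  have hT : (⟨ModularGroup.T ^ M, hTM⟩ : Γ) ∈ stabInfty Γ := by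
    rw [mem_stabInfty_iff]
    change (ModularGroup.T ^ M : SL(2, ℤ)) 1 0 = 0
    rw [← zpow_natCast, ModularGroup.coe_T_zpow]
    simp
  have hTn : ∀ z : ℍ, ((⟨ModularGroup.T ^ M, hTM⟩ : Γ) ^ n) • z = ((n • (M : ℝ) : ℝ)) +ᵥ z := by
    intro z
    change ((ModularGroup.T ^ M : SL(2, ℤ)) ^ n) • z = _
    rw [← zpow_natCast ModularGroup.T, ← zpow_mul, modular_T_zpow_smul]
    congr 1
    push_cast
    rw [zsmul_eq_mul, mul_comm]
  refine ⟨⟨_, _, zpow_mem hT n, rfl⟩, ?_, ?_⟩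
  · change ((⟨ModularGroup.T ^ M, hTM⟩ : Γ) ^ n) • τ ∈ strip M
    rwa [hTn, mem_strip_iff, vadd_re, add_comm]
  · rintro ⟨_, γ, hγ, rfl⟩ h
    obtain ⟨l, hl⟩ := exists_smul_eq_vadd_of_mem_stabInfty hstab hγ
    change (γ : SL(2, ℤ)) • τ ∈ strip M at h
    rw [hl, mem_strip_iff, vadd_re, add_comm] at h
    have hln := huniq l (by simpa using h)
    refine Subtype.ext (Equiv.ext fun z => ?_)
    change (γ : SL(2, ℤ)) • z = ((⟨ModularGroup.T ^ M, hTM⟩ : Γ) ^ n) • z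
    rw [hTn, hl, hln]

end ModularFundamentalDomains

/-! ### Growth and Fourier expansion of cuspidal forms. -/

section CuspForms

variable {p : ℕ} {Γ : Subgroup SL(2, ℤ)} {k : ℝ} {v : SL(2, ℤ) → ℂ} {ρ : Γ →* GL (Fin p) ℂ}

theorem exists_exp_bound_slash_of_mem_vvCuspForms {F : ℍ → EuclideanSpace ℂ (Fin p)}
    (hF : F ∈ vvCuspForms k v ρ) (σ : SL(2, ℤ)) :
    ∃ c > 0, ∃ C, ∀ τ : ℍ, 1 ≤ τ.im → ‖slash k v F σ τ‖ ≤ C * Real.exp (-(c * τ.im)) := by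
  have h : ∀ i, ∃ c > 0, ∃ C, ∀ τ : ℍ, 1 ≤ τ.im →
      ‖slash k v F σ τ i‖ ≤ C * Real.exp (-(c * τ.im)) := by
    intro i
    obtain ⟨h, hh, hexp⟩ := (hF.2 i).2 σ
    simpa only [slash_apply_coord] using hexp.exists_exp_bound hh
  choose c hc C hC using h
  obtain ⟨c₀, hc₀, hcle⟩ : ∃ c₀ > 0, ∀ i, c₀ ≤ c i := by
    -- The common rate is the least of the componentwise rates; for `p = 0` any positive number
    -- serves.
    rcases isEmpty_or_nonempty (Fin p) with h | h
    · exact ⟨1, one_pos, fun i => isEmptyElim i⟩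
    · obtain ⟨i, hi⟩ := Finite.exists_min c
      exact ⟨c i, hc i, hi⟩
  refine ⟨c₀, hc₀, ∑ i, |C i|, fun τ hτ => ?_⟩
  have h1 : ‖slash k v F σ τ‖ ≤ ∑ i, ‖slash k v F σ τ i‖ := by
    rw [EuclideanSpace.norm_eq]
    refine Real.sqrt_le_iff.mpr ⟨by positivity, ?_⟩
    exact Finset.sum_sq_le_sq_sum_of_nonneg fun i _ => norm_nonneg _
  refine h1.trans ?_
  rw [Finset.sum_mul]
  refine Finset.sum_le_sum fun i _ => (hC i τ hτ).trans ?_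
  have := hcle i
  have := τ.im_pos
  gcongr
  exact le_abs_self _

/-- The inequality `x ≤ e^x` at `x = cy/s`, raised to the power `s`. -/
theorem rpow_mul_exp_neg_le {s c : ℝ} (hs : 0 < s) (hc : 0 < c) {y : ℝ} (hy : 0 < y) :
    Real.exp (-(c * y)) * y ^ s ≤ (s / c) ^ s := by
  have h1 : y ≤ s / c * Real.exp (c * y / s) := by
    have h2 := Real.add_one_le_exp (c * y / s)
    calc y = s / c * (c * y / s) := by field_simp
      _ ≤ s / c * Real.exp (c * y / s) := by gcongr; linarith
  have h2 : y ^ s ≤ (s / c) ^ s * Real.exp (c * y) := by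
    calc y ^ s ≤ (s / c * Real.exp (c * y / s)) ^ s := by gcongr
      _ = (s / c) ^ s * Real.exp (c * y) := by
        rw [Real.mul_rpow (by positivity) (by positivity), ← Real.exp_mul]
        congr 2
        field_simp
  calc Real.exp (-(c * y)) * y ^ s ≤ Real.exp (-(c * y)) * ((s / c) ^ s * Real.exp (c * y)) := by
        gcongr
    _ = (s / c) ^ s := by
      rw [mul_left_comm, ← Real.exp_add, neg_add_cancel, Real.exp_zero, mul_one]

theorem continuous_of_mem_vvForms {F : ℍ → EuclideanSpace ℂ (Fin p)} (hF : F ∈ vvForms k v ρ) :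
    Continuous F :=
  continuous_of_mdifferentiable_coord fun i => (hF.1 i).1

/-- For a cuspidal form `F` the function `‖F‖ Im^{k/2}` is bounded. -/
theorem exists_bound_of_mem_vvCuspForms (hk : 0 < k) (hv : IsMultiplierSystem k v)
    (hfin : Γ.FiniteIndex) (hρ : IsUnitaryRep ρ) {F : ℍ → EuclideanSpace ℂ (Fin p)}
    (hF : F ∈ vvCuspForms k v ρ) : ∃ C, ∀ τ : ℍ, ‖F τ‖ * τ.im ^ (k / 2) ≤ C := by
  have hcont : Continuous fun τ : ℍ => ‖F τ‖ * τ.im ^ (k / 2) :=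
    (continuous_of_mem_vvForms hF.1).norm.mul
      (continuous_im.rpow_const fun τ => Or.inl τ.im_ne_zero)
  -- Boundedness at every cusp, phrased as growth of exponent `0`; with invariance under a
  -- finite-index subgroup it gives a global bound.
  have hinf : ∀ g : SL(2, ℤ), (fun τ : ℍ => ‖F (g • τ)‖ * (g • τ).im ^ (k / 2)) =O[atImInfty]
      fun τ => τ.im ^ (0 : ℝ) := by
    intro g
    obtain ⟨c, hc, C, hC⟩ := exists_exp_bound_slash_of_mem_vvCuspForms hF g
    refine Asymptotics.IsBigO.of_bound (|C| * (k / 2 / c) ^ (k / 2)) ?_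
    refine (atImInfty_mem _).mpr ⟨1, fun τ hτ => ?_⟩
    have hy := τ.im_pos
    change ‖‖F (g • τ)‖ * (g • τ).im ^ (k / 2)‖ ≤ _
    rw [← norm_slash_mul_im_rpow hv, Real.rpow_zero, norm_one, mul_one, norm_mul, norm_norm,
      Real.norm_of_nonneg (by positivity)]
    calc ‖slash k v F g τ‖ * τ.im ^ (k / 2)
        ≤ (|C| * Real.exp (-(c * τ.im))) * τ.im ^ (k / 2) := by
          gcongr
          exact (hC τ hτ).trans (by gcongr; exact le_abs_self C)
      _ = |C| * (Real.exp (-(c * τ.im)) * τ.im ^ (k / 2)) := by ring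
      _ ≤ |C| * (k / 2 / c) ^ (k / 2) := by
          gcongr
          exact rpow_mul_exp_neg_le (by linarith) hc hy
  have hinv : ∀ g ∈ Γ, ∀ τ : ℍ, ‖F (g • τ)‖ * (g • τ).im ^ (k / 2) = ‖F τ‖ * τ.im ^ (k / 2) := by
    intro g hg τ
    exact smul_im_rpow_norm_of_invariant (γ := ⟨g, hg⟩) hv hρ
      (slashRep_eq_self_iff.mpr (hF.1.2 ⟨g, hg⟩)) τ
  obtain ⟨C, hC⟩ := ModularGroup.exists_bound_of_subgroup_invariant_of_isBigO hcont le_rfl hinf hinv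
  refine ⟨C, fun τ => ?_⟩
  have := hC τ
  rw [Real.rpow_zero, mul_one] at this
  exact (le_abs_self _).trans this

theorem toEuclideanLin_diagonal_apply (d : Fin p → ℂ) (x : EuclideanSpace ℂ (Fin p)) (j : Fin p) :
    Matrix.toEuclideanLin (Matrix.diagonal d) x j = d j * x j := by
  simp [Matrix.toLpLin_apply, Matrix.mulVec_diagonal]

theorem toEuclideanLin_coord_vadd (hv : IsMultiplierSystem k v) {κ : ℝ}
    (hvT : v ModularGroup.T = Complex.exp (2 * Real.pi * Complex.I * κ)) {M : ℕ}
    (hTM : ModularGroup.T ^ M ∈ Γ) {U : Matrix.unitaryGroup (Fin p) ℂ} {m : Fin p → ℚ}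
    (hU : (ρ ⟨ModularGroup.T ^ M, hTM⟩).val =
      Complex.exp (-(2 * Real.pi * Complex.I * κ * M)) •
        ((U⁻¹).val *
          Matrix.diagonal (fun i => Complex.exp (2 * Real.pi * Complex.I * (m i : ℂ))) * U.val))
    {F : ℍ → EuclideanSpace ℂ (Fin p)} (hF : F ∈ vvForms k v ρ) (j : Fin p) (τ : ℍ) :
    Matrix.toEuclideanLin U.val (F ((M : ℝ) +ᵥ τ)) j =
      Complex.exp (2 * Real.pi * Complex.I * (m j : ℂ)) *
        Matrix.toEuclideanLin U.val (F τ) j := by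
  have h := hF.2 ⟨ModularGroup.T ^ M, hTM⟩ τ
  have hUU : U.val * (U⁻¹).val = 1 := by
    rw [← Submonoid.coe_mul, mul_inv_cancel, Submonoid.coe_one]
  rw [slash_T_pow hv hvT, hU, map_smul, LinearMap.smul_apply] at h
  rw [smul_right_injective _ (Complex.exp_ne_zero _) h, ← toEuclideanLin_mul_apply, ← mul_assoc,
    ← mul_assoc, hUU, one_mul, toEuclideanLin_mul_apply]
  exact toEuclideanLin_diagonal_apply _ _ j

/-- The Fourier expansion of the components of `U F` at `∞`. -/
theorem exists_isFourierExpansion (hv : IsMultiplierSystem k v) {κ : ℝ}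
    (hvT : v ModularGroup.T = Complex.exp (2 * Real.pi * Complex.I * κ)) {M : ℕ} (hM : 0 < M)
    (hTM : ModularGroup.T ^ M ∈ Γ) {U : Matrix.unitaryGroup (Fin p) ℂ} {m : Fin p → ℚ} {j : Fin p}
    (hmj : m j ≤ 1)
    (hU : (ρ ⟨ModularGroup.T ^ M, hTM⟩).val =
      Complex.exp (-(2 * Real.pi * Complex.I * κ * M)) •
        ((U⁻¹).val *
          Matrix.diagonal (fun i => Complex.exp (2 * Real.pi * Complex.I * (m i : ℂ))) * U.val))
    {F : ℍ → EuclideanSpace ℂ (Fin p)} (hF : F ∈ vvCuspForms k v ρ) :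
    ∃ b : ℕ → ℂ, IsFourierExpansion M m U j F b := by
  have hM' : (M : ℂ) ≠ 0 := by exact_mod_cast hM.ne'
  have hMr : (0 : ℝ) < M := by exact_mod_cast hM
  have hmj' : (m j : ℝ) ≤ 1 := by exact_mod_cast hmj
  -- The twist makes the function `M`-periodic. Taking `1 - m_j ≥ 0` rather than `-m_j` preserves
  -- decay at `i∞`, so the exponents of `g` are `(n + 1)/M` with `n ≥ 0`; undoing the twist turns
  -- them into `(n + m_j)/M`.
  let g : ℍ → ℂ := fun τ =>
    Complex.exp (2 * Real.pi * Complex.I * (((1 - m j) / M : ℝ) : ℂ) * τ) *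
      Matrix.toEuclideanLin U.val (F τ) j
  have hper : ∀ τ, g ((M : ℝ) +ᵥ τ) = g τ := by
    intro τ
    simp only [g]
    rw [toEuclideanLin_coord_vadd hv hvT hTM hU hF.1, ← mul_assoc, ← Complex.exp_add]
    congr 1
    rw [Complex.exp_eq_exp_iff_exists_int]
    refine ⟨1, ?_⟩
    rw [coe_vadd]
    push_cast
    field_simp
    ring
  have hd : MDifferentiable 𝓘(ℂ) 𝓘(ℂ) g := by
    refine MDifferentiable.mul ?_ (mdifferentiable_toEuclideanLin_coord (fun i => (hF.1.1 i).1) _ j)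
    have : Differentiable ℂ fun z : ℂ =>
        Complex.exp (2 * Real.pi * Complex.I * (((1 - m j) / M : ℝ) : ℂ) * z) := by fun_prop
    exact this.mdifferentiable.comp mdifferentiable_coe
  have hzero : IsZeroAtImInfty g := by
    obtain ⟨c, hc, C, hC⟩ := exists_exp_bound_slash_of_mem_vvCuspForms hF 1
    rw [slash_one hv] at hC
    have hlim : Filter.Tendsto (fun τ : ℍ => C * Real.exp (-(c * τ.im))) atImInfty (nhds 0) := by
      rw [← mul_zero C]
      refine (Real.tendsto_exp_neg_atTop_nhds_zero.comp ?_).const_mul C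
      exact Filter.tendsto_comap.const_mul_atTop hc
    refine squeeze_zero_norm' ?_ hlim
    refine (atImInfty_mem _).mpr ⟨1, fun τ hτ => ?_⟩
    have hy := τ.im_pos
    change ‖Complex.exp _ * _‖ ≤ _
    rw [norm_mul, norm_exp_two_pi_I_mul]
    have h1 : Real.exp (-(2 * Real.pi * ((1 - m j) / M) * τ.im)) ≤ 1 := by
      rw [Real.exp_le_one_iff, neg_nonpos]
      have : 0 ≤ 1 - (m j : ℝ) := by linarith
      positivity
    refine (mul_le_of_le_one_left (norm_nonneg _) h1).trans ((PiLp.norm_apply_le _ j).trans ?_)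
    rw [norm_toEuclideanLin_unitary U.2]
    exact hC τ hτ
  obtain ⟨a, ha⟩ := exists_hasSum_of_periodic_of_isZeroAtImInfty hM hper hd hzero
  refine ⟨a, fun τ => ?_⟩
  have h := (ha τ).mul_left
    (Complex.exp (-(2 * Real.pi * Complex.I * (((1 - m j) / M : ℝ) : ℂ) * τ)))
  simp only [g] at h
  rw [← mul_assoc, ← Complex.exp_add, neg_add_cancel, Complex.exp_zero, one_mul] at h
  refine h.congr_fun fun n => ?_
  rw [mul_left_comm, ← Complex.exp_add]
  congr 2
  push_cast
  field_simp
  ring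

end CuspForms

/-! ### Integration over the strip in the coordinates `x` and `y`. -/

section StripIntegral

theorem measurePreserving_re_im :
    MeasurePreserving (fun τ : ℍ => (τ.re, τ.im)) (volume.comap UpperHalfPlane.coe)
      ((volume : Measure (ℝ × ℝ)).restrict (Set.univ ×ˢ Set.Ioi 0)) := by
  have h1 : MeasurePreserving UpperHalfPlane.coe (volume.comap UpperHalfPlane.coe)
      ((volume : Measure ℂ).restrict (Set.range UpperHalfPlane.coe)) :=
    ⟨measurable_coe, by rw [measurableEmbedding_coe.map_comap]⟩
  have h2 := Complex.volume_preserving_equiv_real_prod.restrict_preimage_emb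
    Complex.measurableEquivRealProd.measurableEmbedding (Set.univ ×ˢ Set.Ioi 0)
  have h3 : Complex.measurableEquivRealProd ⁻¹' (Set.univ ×ˢ Set.Ioi 0) =
      Set.range UpperHalfPlane.coe := by
    ext z
    simp only [Set.mem_preimage, Set.mem_prod, Set.mem_univ, true_and, Set.mem_Ioi, Set.mem_range,
      Complex.measurableEquivRealProd_apply]
    exact ⟨fun h => ⟨⟨z, h⟩, rfl⟩, by rintro ⟨τ, rfl⟩; exact τ.im_pos⟩
  rw [h3] at h2
  exact h2.comp h1

theorem measurableEmbedding_re_im : MeasurableEmbedding (fun τ : ℍ => (τ.re, τ.im)) :=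
  Complex.measurableEquivRealProd.measurableEmbedding.comp measurableEmbedding_coe

theorem measurable_density :
    Measurable fun τ : ℍ => ((1 / NNReal.mk τ.im τ.im_pos.le : NNReal) ^ 2) := by
  refine Measurable.pow_const (Measurable.const_div ?_ _) _
  exact continuous_im.measurable.subtype_mk

variable {E : Type*} [NormedAddCommGroup E] [NormedSpace ℝ E]

theorem density_smul_eq (h : ℍ → E) (τ : ℍ) :
    ((1 / NNReal.mk τ.im τ.im_pos.le : NNReal) ^ 2) • h τ =
      (fun z : ℝ × ℝ => (z.2 ^ 2)⁻¹ • h (ofComplex (z.1 + z.2 * Complex.I))) (τ.re, τ.im) := by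
  have h1 : ((τ.re : ℂ) + τ.im * Complex.I) = τ := Complex.re_add_im (τ : ℂ)
  simp only
  rw [h1, ofComplex_apply, NNReal.smul_def]
  congr 1
  push_cast
  simp

theorem preimage_re_im (M : ℕ) :
    (fun τ : ℍ => (τ.re, τ.im)) ⁻¹' (Set.Ico (0 : ℝ) M ×ˢ Set.univ) = strip M := by
  ext τ
  simp [mem_strip_iff]

theorem restrict_restrict_strip (M : ℕ) :
    ((volume : Measure (ℝ × ℝ)).restrict (Set.univ ×ˢ Set.Ioi 0)).restrict
      (Set.Ico (0 : ℝ) M ×ˢ Set.univ) =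
      (volume.restrict (Set.Ico (0 : ℝ) M)).prod (volume.restrict (Set.Ioi (0 : ℝ))) := by
  rw [Measure.restrict_restrict (measurableSet_Ico.prod MeasurableSet.univ), Set.prod_inter_prod,
    Set.inter_univ, Set.univ_inter, Measure.prod_restrict, Measure.volume_eq_prod]

theorem integrableOn_strip_iff (M : ℕ) (h : ℍ → E) :
    IntegrableOn h (strip M) ↔
      Integrable (fun z : ℝ × ℝ => (z.2 ^ 2)⁻¹ • h (ofComplex (z.1 + z.2 * Complex.I)))
        ((volume.restrict (Set.Ico (0 : ℝ) M)).prod (volume.restrict (Set.Ioi (0 : ℝ)))) := by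
  rw [IntegrableOn, volume_def, restrict_withDensity (measurableSet_strip M),
    integrable_withDensity_iff_integrable_smul measurable_density]
  simp only [density_smul_eq]
  rw [← restrict_restrict_strip, ← preimage_re_im M]
  exact measurePreserving_re_im.integrableOn_comp_preimage measurableEmbedding_re_im
    (f := fun z : ℝ × ℝ => (z.2 ^ 2)⁻¹ • h (ofComplex (z.1 + z.2 * Complex.I)))
    (s := Set.Ico (0 : ℝ) M ×ˢ Set.univ)

theorem setIntegral_strip (M : ℕ) (h : ℍ → E) :
    ∫ τ in strip M, h τ =
      ∫ z, (z.2 ^ 2)⁻¹ • h (ofComplex (z.1 + z.2 * Complex.I))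
        ∂(volume.restrict (Set.Ico (0 : ℝ) M)).prod (volume.restrict (Set.Ioi (0 : ℝ))) := by
  rw [volume_def, restrict_withDensity (measurableSet_strip M),
    integral_withDensity_eq_integral_smul measurable_density]
  simp only [density_smul_eq]
  rw [← restrict_restrict_strip, ← preimage_re_im M]
  exact measurePreserving_re_im.setIntegral_preimage_emb measurableEmbedding_re_im
    (fun z : ℝ × ℝ => (z.2 ^ 2)⁻¹ • h (ofComplex (z.1 + z.2 * Complex.I))) _

theorem ofComplex_im {x y : ℝ} (hy : 0 < y) :
    (ofComplex ((x : ℂ) + y * Complex.I)).im = y := by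
  rw [ofComplex_apply_of_im_pos (by simpa using hy)]
  simp [UpperHalfPlane.im]

theorem coe_ofComplex_mk {x y : ℝ} (hy : 0 < y) :
    (ofComplex ((x : ℂ) + y * Complex.I) : ℂ) = x + y * Complex.I := by
  rw [ofComplex_apply_of_im_pos (by simpa using hy)]

theorem integrableOn_rpow_mul_exp_neg {s c : ℝ} (hs : 1 < s) (hc : 0 < c) :
    IntegrableOn (fun y : ℝ => y ^ (s - 2) * Real.exp (-(c * y))) (Set.Ioi 0) := by
  have h := Real.integral_rpow_mul_exp_neg_mul_Ioi (a := s - 1) (r := c) (by linarith) hc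
  rw [show s - 1 - 1 = s - 2 by ring] at h
  -- A non-integrable function has integral `0` by convention, so the nonzero Gamma value already
  -- proves integrability.
  refine Integrable.of_integral_ne_zero ?_
  rw [h]
  have := Real.Gamma_pos_of_pos (show 0 < s - 1 by linarith)
  positivity

theorem inv_sq_mul_rpow {y : ℝ} (hy : 0 < y) (s : ℝ) : (y ^ 2)⁻¹ * y ^ s = y ^ (s - 2) := by
  rw [Real.rpow_sub hy, Real.rpow_two]
  ring

/-- A continuous function that is `O(Im^s e^{-c Im})`, with `s > 1`, is integrable over a strip. -/
theorem integrableOn_strip_of_bound {E : Type*} [NormedAddCommGroup E] {M : ℕ} {h : ℍ → E}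
    (hcont : Continuous h) {s c C : ℝ} (hs : 1 < s) (hc : 0 < c)
    (hb : ∀ τ, ‖h τ‖ ≤ C * (τ.im ^ s * Real.exp (-(c * τ.im)))) :
    IntegrableOn h (strip M) := by
  have hbint : IntegrableOn (fun τ : ℍ => C * (τ.im ^ s * Real.exp (-(c * τ.im)))) (strip M) := by
    refine Integrable.const_mul ?_ C
    change IntegrableOn (fun τ : ℍ => τ.im ^ s * Real.exp (-(c * τ.im))) (strip M) volume
    rw [integrableOn_strip_iff]
    have h1 : Integrable (fun _ : ℝ => (1 : ℝ)) (volume.restrict (Set.Ico (0 : ℝ) M)) :=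
      integrable_const _
    refine (h1.mul_prod (integrableOn_rpow_mul_exp_neg hs hc)).congr ?_
    rw [Measure.prod_restrict]
    refine (ae_restrict_iff' (measurableSet_Ico.prod measurableSet_Ioi)).mpr
      (Filter.Eventually.of_forall fun z hz => ?_)
    have hz2 : 0 < z.2 := hz.2
    beta_reduce
    rw [ofComplex_im hz2, smul_eq_mul, one_mul, ← mul_assoc, inv_sq_mul_rpow hz2]
  exact hbint.mono' hcont.aestronglyMeasurable (Filter.Eventually.of_forall hb)

/-- Integration over a strip, first along horizontal lines. -/
theorem setIntegral_strip_eq_integral_integral {M : ℕ} {h : ℍ → E}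
    (hint : IntegrableOn h (strip M)) :
    ∫ τ in strip M, h τ = ∫ y in Set.Ioi (0 : ℝ), (y ^ 2)⁻¹ •
      ∫ x in Set.Ico (0 : ℝ) M, h (ofComplex (x + y * Complex.I)) := by
  rw [setIntegral_strip, integral_prod_symm _ ((integrableOn_strip_iff M h).mp hint)]
  simp only [integral_smul]

end StripIntegral

/-! ### Orthogonality of exponentials on a period. -/

section Orthogonality

theorem integral_exp_two_pi_I_int {M : ℕ} (hM : 0 < M) (l : ℤ) :
    ∫ x in Set.Ico (0 : ℝ) M, Complex.exp (2 * Real.pi * Complex.I * (l / M) * x) =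
      if l = 0 then (M : ℂ) else 0 := by
  have hM' : (M : ℂ) ≠ 0 := by exact_mod_cast hM.ne'
  rw [integral_Ico_eq_integral_Ioc, ← intervalIntegral.integral_of_le (Nat.cast_nonneg M)]
  split_ifs with h
  · simp [h]
  · have hl : (l : ℂ) ≠ 0 := by exact_mod_cast h
    rw [integral_exp_mul_complex (mul_ne_zero Complex.two_pi_I_ne_zero (div_ne_zero hl hM'))]
    have h1 : Complex.exp (2 * Real.pi * Complex.I * (l / M) * ((M : ℝ) : ℂ)) = 1 := by
      rw [Complex.exp_eq_one_iff]
      refine ⟨l, ?_⟩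
      push_cast
      field_simp
    rw [h1]
    simp

theorem conj_exp_mul_exp (a b x y : ℝ) :
    (starRingEnd ℂ) (Complex.exp (2 * Real.pi * Complex.I * a * (x + y * Complex.I))) *
      Complex.exp (2 * Real.pi * Complex.I * b * (x + y * Complex.I)) =
    Complex.exp (2 * Real.pi * Complex.I * ((b - a : ℝ) : ℂ) * x) *
      (Real.exp (-(2 * Real.pi * (a + b) * y)) : ℂ) := by
  rw [← Complex.exp_conj, ← Complex.exp_add, Complex.ofReal_exp, ← Complex.exp_add]
  congr 1
  simp only [map_mul, map_add, Complex.conj_I, Complex.conj_ofReal, map_ofNat]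
  push_cast
  linear_combination (2 * Real.pi * y * (b + a) : ℂ) * Complex.I_sq

end Orthogonality

/-! ### Integrability of a sum of functions. -/

section IntegralOfSum

/-- Tonelli applied to the norms; it yields the absolute convergence of the Petersson integral. -/
theorem integrable_of_hasSum {α ι E : Type*} [MeasurableSpace α] {μ : Measure α} [Countable ι]
    [NormedAddCommGroup E] {F : ι → α → E} {G : α → E} (hF : ∀ i, Integrable (F i) μ)
    (hsum : Summable fun i => ∫ a, ‖F i a‖ ∂μ) (hG : ∀ a, HasSum (fun i => F i a) (G a))
    (hGm : AEStronglyMeasurable G μ) : Integrable G μ := by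
  refine ⟨hGm, ?_⟩
  calc ∫⁻ a, ‖G a‖ₑ ∂μ ≤ ∫⁻ a, ∑' i, ‖F i a‖ₑ ∂μ :=
        lintegral_mono fun a => (hG a).tsum_eq ▸ enorm_tsum_le_tsum_enorm
    _ = ∑' i, ENNReal.ofReal (∫ a, ‖F i a‖ ∂μ) := by
        rw [lintegral_tsum fun i => (hF i).1.enorm]
        exact tsum_congr fun i => (ofReal_integral_norm_eq_lintegral_enorm (hF i)).symm
    _ < ⊤ := lt_top_iff_ne_top.mpr hsum.tsum_ofReal_ne_top

end IntegralOfSum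

/-! ### The seed function and its integral against a cuspidal form. -/

section ExpVector

variable {p : ℕ} {k : ℝ} {M : ℕ} {m : Fin p → ℚ} {U : Matrix.unitaryGroup (Fin p) ℂ} {j : Fin p}

/-- The exponents `(n + m_j) / M` of the Fourier expansions. -/
def frequency (M : ℕ) (m : Fin p → ℚ) (j : Fin p) (n : ℕ) : ℝ := ((n : ℝ) + (m j : ℝ)) / M

theorem ofReal_frequency (n : ℕ) :
    ((frequency M m j n : ℝ) : ℂ) = ((n : ℂ) + (m j : ℂ)) / M := by
  rw [frequency]
  push_cast
  rfl

theorem frequency_pos (hM : 0 < M) (hmj : 0 < m j) (n : ℕ) : 0 < frequency M m j n := by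
  have h1 : (0 : ℝ) < M := by exact_mod_cast hM
  have h2 : (0 : ℝ) < m j := by exact_mod_cast hmj
  rw [frequency]
  positivity

theorem expVector_eq (ν : ℕ) (τ : ℍ) : expVector M m U ν j τ =
    Complex.exp (2 * Real.pi * Complex.I * (frequency M m j ν : ℝ) * τ) •
      Matrix.toEuclideanLin (U⁻¹).val (EuclideanSpace.single j (1 : ℂ)) := by
  rw [ofReal_frequency]
  rfl

theorem norm_expVector (ν : ℕ) (τ : ℍ) : ‖expVector M m U ν j τ‖ =
    Real.exp (-(2 * Real.pi * frequency M m j ν * τ.im)) := by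
  rw [expVector_eq, norm_smul, norm_toEuclideanLin_unitary (U⁻¹).2, norm_exp_two_pi_I_mul]
  simp

theorem norm_expVector_le_one (hM : 0 < M) (hmj : 0 < m j) (ν : ℕ) (τ : ℍ) :
    ‖expVector M m U ν j τ‖ ≤ 1 := by
  have h1 := frequency_pos hM hmj ν
  have h2 := τ.im_pos
  rw [norm_expVector, Real.exp_le_one_iff, neg_nonpos]
  positivity

theorem norm_expVector_mul_im_rpow_le (hk : 0 < k) (hM : 0 < M) (hmj : 0 < m j) (ν : ℕ) (τ : ℍ) :
    ‖expVector M m U ν j τ‖ * τ.im ^ (k / 2) ≤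
      (k / 2 / (2 * Real.pi * frequency M m j ν)) ^ (k / 2) := by
  have h1 := frequency_pos hM hmj ν
  rw [norm_expVector]
  exact rpow_mul_exp_neg_le (by positivity) (by positivity) τ.im_pos

theorem mdifferentiable_expVector (ν : ℕ) (i : Fin p) :
    MDifferentiable 𝓘(ℂ) 𝓘(ℂ) (fun τ => expVector M m U ν j τ i) := by
  refine (mdifferentiable_iff).mpr ?_
  have h : Set.EqOn ((fun τ => expVector M m U ν j τ i) ∘ ofComplex)
      (fun z => Complex.exp (2 * Real.pi * Complex.I * (((ν : ℂ) + (m j : ℂ)) / M) * z) *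
        Matrix.toEuclideanLin (U⁻¹).val (EuclideanSpace.single j (1 : ℂ)) i)
      {z | 0 < z.im} := by
    intro z hz
    simp only [Function.comp_apply, ofComplex_apply_of_im_pos hz]
    rfl
  refine DifferentiableOn.congr ?_ h
  fun_prop

/-- Applying the unitary `U` to both arguments turns `U⁻¹ e_j` into `e_j`, which reads off the
`j`-th coordinate of `UF`. -/
theorem peterssonIntegrand_expVector (F : ℍ → EuclideanSpace ℂ (Fin p)) (ν : ℕ) (τ : ℍ) :
    peterssonIntegrand k F (expVector M m U ν j) τ =
      (starRingEnd ℂ) (Complex.exp (2 * Real.pi * Complex.I * (frequency M m j ν : ℝ) * τ)) *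
        Matrix.toEuclideanLin U.val (F τ) j * ((τ.im ^ k : ℝ) : ℂ) := by
  have h : U.val * (U⁻¹).val = 1 := by
    rw [← Submonoid.coe_mul, mul_inv_cancel, Submonoid.coe_one]
  rw [peterssonIntegrand, expVector_eq, inner_smul_left, ← inner_toEuclideanLin_unitary U.2,
    ← toEuclideanLin_mul_apply, h, toEuclideanLin_one_apply, EuclideanSpace.inner_single_left,
    map_one, one_mul]

theorem norm_peterssonIntegrand_le (F G : ℍ → EuclideanSpace ℂ (Fin p)) (τ : ℍ) :
    ‖peterssonIntegrand k F G τ‖ ≤ (‖F τ‖ * τ.im ^ (k / 2)) * (‖G τ‖ * τ.im ^ (k / 2)) := by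
  have h : τ.im ^ k = τ.im ^ (k / 2) * τ.im ^ (k / 2) := by
    rw [← Real.rpow_add τ.im_pos, add_halves]
  have h' : 0 ≤ τ.im ^ k := Real.rpow_nonneg τ.im_pos.le k
  rw [peterssonIntegrand, norm_mul, Complex.norm_real, Real.norm_of_nonneg h']
  calc _ ≤ ‖G τ‖ * ‖F τ‖ * τ.im ^ k := by gcongr; exact norm_inner_le_norm _ _
    _ = _ := by rw [h]; ring

theorem continuous_peterssonIntegrand {F G : ℍ → EuclideanSpace ℂ (Fin p)} (hF : Continuous F)
    (hG : Continuous G) : Continuous (peterssonIntegrand k F G) :=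
  (hG.inner hF).mul (Complex.continuous_ofReal.comp
    (continuous_im.rpow_const fun τ => Or.inl τ.im_ne_zero))

/-- Half of `Im^k` is spent on bounding `F`; the other half, `Im^{k/2}`, still beats the density
`y^{-2}` near the real line because `k/2 > 1`. -/
theorem integrableOn_strip_peterssonIntegrand_expVector (hk : 2 < k) (hM : 0 < M) (hmj : 0 < m j)
    {F : ℍ → EuclideanSpace ℂ (Fin p)} (hF : Continuous F) {C : ℝ}
    (hC : ∀ τ, ‖F τ‖ * τ.im ^ (k / 2) ≤ C) (ν : ℕ) :
    IntegrableOn (peterssonIntegrand k F (expVector M m U ν j)) (strip M) := by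
  have h1 := frequency_pos hM hmj ν
  refine integrableOn_strip_of_bound (s := k / 2) (c := 2 * Real.pi * frequency M m j ν) (C := C)
    (continuous_peterssonIntegrand hF
      (continuous_of_mdifferentiable_coord (mdifferentiable_expVector ν)))
    (by linarith) (by positivity) fun τ => ?_
  refine (norm_peterssonIntegrand_le _ _ τ).trans ?_
  rw [norm_expVector, mul_comm (Real.exp _)]
  have := τ.im_pos
  gcongr
  exact hC τ

/-- The integral over a horizontal segment extracts a Fourier coefficient. -/
theorem integral_horizontal_peterssonIntegrand (hM : 0 < M) {F : ℍ → EuclideanSpace ℂ (Fin p)}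
    {b : ℕ → ℂ} (hb : IsFourierExpansion M m U j F b) (ν : ℕ) {y : ℝ} (hy : 0 < y) :
    ∫ x in Set.Ico (0 : ℝ) M,
      peterssonIntegrand k F (expVector M m U ν j) (ofComplex (x + y * Complex.I)) =
    M * b ν * ((y ^ k * Real.exp (-(4 * Real.pi * frequency M m j ν * y)) : ℝ) : ℂ) := by
  have hM' : (M : ℂ) ≠ 0 := by exact_mod_cast hM.ne'
  set a := frequency M m j ν with ha
  set G : ℕ → ℝ → ℂ := fun n x => b n * (Complex.exp (2 * Real.pi * Complex.I *
    (((n : ℤ) - (ν : ℤ) : ℤ) / M) * x) *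
      (Real.exp (-(2 * Real.pi * (a + frequency M m j n) * y)) : ℂ)) with hG
  have hsum : ∀ x : ℝ, HasSum (fun n => G n x)
      ((starRingEnd ℂ) (Complex.exp (2 * Real.pi * Complex.I * a * (x + y * Complex.I))) *
        Matrix.toEuclideanLin U.val (F (ofComplex (x + y * Complex.I))) j) := by
    intro x
    refine ((hb (ofComplex (x + y * Complex.I))).mul_left _).congr_fun fun n => ?_
    rw [coe_ofComplex_mk hy, ← ofReal_frequency, mul_left_comm, conj_exp_mul_exp]
    simp only [hG]
    congr 5
    rw [ha, frequency, frequency]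
    push_cast
    field_simp
    ring
  have hnorm : ∀ n x, ‖G n x‖ =
      ‖b n‖ * Real.exp (-(2 * Real.pi * (a + frequency M m j n) * y)) := by
    intro n x
    rw [norm_mul, norm_mul, Complex.norm_real, Real.norm_of_nonneg (Real.exp_pos _).le,
      show (2 * Real.pi * Complex.I * (((n : ℤ) - (ν : ℤ) : ℤ) / M) * x : ℂ) =
        ((2 * Real.pi * ((((n : ℤ) - (ν : ℤ) : ℤ) : ℝ) / M) * x : ℝ) : ℂ) * Complex.I by
        push_cast; ring, Complex.norm_exp_ofReal_mul_I, one_mul]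
  have hint : ∀ n, Integrable (G n) (volume.restrict (Set.Ico (0 : ℝ) M)) := fun n =>
    (Continuous.integrableOn_Icc (by fun_prop)).mono_set Set.Ico_subset_Icc_self
  have hsumm : Summable fun n => ∫ x, ‖G n x‖ ∂(volume.restrict (Set.Ico (0 : ℝ) M)) := by
    simp only [hnorm, integral_const]
    refine Summable.const_smul _ ?_
    -- The norms do not depend on `x`, so absolute convergence of the Fourier series at `iy` alone
    -- gives summability of the integrals.
    have h := (hb (ofComplex ((0 : ℝ) + y * Complex.I))).summable.norm.mul_left
      (Real.exp (-(2 * Real.pi * a * y)))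
    refine h.congr fun n => ?_
    rw [norm_mul, ← ofReal_frequency, norm_exp_two_pi_I_mul, ofComplex_im hy, mul_left_comm,
      ← Real.exp_add]
    ring_nf
  have h := hasSum_integral_of_summable_integral_norm hint hsumm
  simp only [(hsum _).tsum_eq] at h
  have hcoef : ∀ n, ∫ x in Set.Ico (0 : ℝ) M, G n x =
      if n = ν then M * b ν * (Real.exp (-(4 * Real.pi * a * y)) : ℂ) else 0 := by
    intro n
    simp only [hG]
    rw [integral_const_mul, integral_mul_const, integral_exp_two_pi_I_int hM]
    by_cases hn : n = ν
    · subst hn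
      rw [if_pos (sub_self _), if_pos rfl, ← ha]
      ring_nf
    · rw [if_neg hn, if_neg (by rwa [sub_eq_zero, Nat.cast_inj]), zero_mul, mul_zero]
  simp only [hcoef] at h
  have h2 := h.unique (hasSum_ite_eq ν _)
  simp only [peterssonIntegrand_expVector, coe_ofComplex_mk hy, ofComplex_im hy]
  rw [integral_mul_const, h2]
  push_cast
  ring

/-- After the horizontal integration there remains a Gamma integral with parameter `k - 1` and rate
`4π(ν + m_j)/M`; the period length `M` times `M^{k-1}` gives `M^k`. -/
theorem integral_strip_peterssonIntegrand_expVector (hk : 2 < k) (hM : 0 < M) (hmj : 0 < m j)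
    {F : ℍ → EuclideanSpace ℂ (Fin p)} (hF : Continuous F) {C : ℝ}
    (hC : ∀ τ, ‖F τ‖ * τ.im ^ (k / 2) ≤ C)
    {b : ℕ → ℂ} (hb : IsFourierExpansion M m U j F b) (ν : ℕ) :
    ∫ τ in strip M, peterssonIntegrand k F (expVector M m U ν j) τ =
      b ν * (((M : ℝ) ^ k * Real.Gamma (k - 1) /
        (4 * Real.pi * ((ν : ℝ) + (m j : ℝ))) ^ (k - 1) : ℝ) : ℂ) := by
  have h1 := frequency_pos hM hmj ν
  have hM' : (0 : ℝ) < M := by exact_mod_cast hM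
  have hm' : (0 : ℝ) < m j := by exact_mod_cast hmj
  rw [setIntegral_strip_eq_integral_integral
    (integrableOn_strip_peterssonIntegrand_expVector hk hM hmj hF hC ν)]
  have h2 : ∀ y ∈ Set.Ioi (0 : ℝ), (y ^ 2)⁻¹ • ∫ x in Set.Ico (0 : ℝ) M,
      peterssonIntegrand k F (expVector M m U ν j) (ofComplex (x + y * Complex.I)) =
      M * b ν * ((y ^ (k - 1 - 1) * Real.exp (-(4 * Real.pi * frequency M m j ν * y)) : ℝ) : ℂ) := by
    intro y hy
    rw [integral_horizontal_peterssonIntegrand hM hb ν hy, Complex.real_smul, mul_left_comm,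
      ← Complex.ofReal_mul, ← mul_assoc, inv_sq_mul_rpow hy, sub_sub]
    norm_num
  rw [setIntegral_congr_fun measurableSet_Ioi h2, integral_const_mul, integral_complex_ofReal,
    Real.integral_rpow_mul_exp_neg_mul_Ioi (by linarith) (by positivity)]
  have h3 : (M : ℝ) * ((1 / (4 * Real.pi * frequency M m j ν)) ^ (k - 1) * Real.Gamma (k - 1)) =
      (M : ℝ) ^ k * Real.Gamma (k - 1) / (4 * Real.pi * ((ν : ℝ) + (m j : ℝ))) ^ (k - 1) := by
    rw [show 1 / (4 * Real.pi * frequency M m j ν) = M / (4 * Real.pi * ((ν : ℝ) + (m j : ℝ))) by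
      rw [frequency]; field_simp, Real.div_rpow hM'.le (by positivity),
      show (M : ℝ) ^ k = M * (M : ℝ) ^ (k - 1) by
        rw [← Real.rpow_one_add' hM'.le (by linarith), add_sub_cancel]]
    ring
  rw [← h3]
  push_cast
  ring

end ExpVector

/-! ### Unfolding the Petersson product with a Poincaré series. -/

section Unfolding

variable {p : ℕ} {Γ : Subgroup SL(2, ℤ)} {k : ℝ} {v : SL(2, ℤ) → ℂ} {ρ : Γ →* GL (Fin p) ℂ}

/-- The Petersson inner product with a Poincaré series, as an integral over a fundamental domain
for `Γ_∞`. -/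
theorem petersson_poincareSeries (hk : 2 < k) (hv : IsMultiplierSystem k v) (hρ : IsUnitaryRep ρ)
    {f : ℍ → EuclideanSpace ℂ (Fin p)} (hf : ∀ τ, ‖f τ‖ ≤ 1)
    (hinv : ∀ l ∈ stabInfty Γ, slashRep k v ρ f l = f)
    (hcont : Continuous (poincareSeries k v ρ (stabInfty Γ) f))
    {F : ℍ → EuclideanSpace ℂ (Fin p)} (hF : F ∈ vvForms k v ρ) {D S : Set ℍ}
    (hD : IsFundDomain Γ D)
    (hS : IsFundamentalDomain ((stabInfty Γ).map (MulAction.toPermHom Γ ℍ)) S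
      (volume : Measure ℍ))
    (hint : IntegrableOn (peterssonIntegrand k F f) S) :
    IntegrableOn (peterssonIntegrand k F (poincareSeries k v ρ (stabInfty Γ) f)) D ∧
    petersson k D F (poincareSeries k v ρ (stabInfty Γ) f) =
      ∫ τ in S, peterssonIntegrand k F f τ := by
  have hFinv : ∀ γ : Γ, slashRep k v ρ F γ = F := fun γ => slashRep_eq_self_iff.mpr (hF.2 γ)
  have hterm : ∀ (q : RightCosets (stabInfty Γ)) (τ : ℍ),
      peterssonIntegrand k F f (q.out • τ) =
        peterssonIntegrand k F (poincareTerm k v ρ (stabInfty Γ) f q) τ := fun q τ =>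
    peterssonIntegrand_smul_of_invariant hv hρ (hFinv q.out) f τ
  have hg : ∀ l ∈ stabInfty Γ, ∀ τ : ℍ,
      peterssonIntegrand k F f (l • τ) = peterssonIntegrand k F f τ := by
    intro l hl τ
    conv_rhs => rw [← hinv l hl]
    exact peterssonIntegrand_smul_of_invariant hv hρ (hFinv l) f τ
  obtain ⟨h1, h2⟩ := unfolding ker_toPermHom_le_stabInfty hD hS hg hint
  -- Unfolding the norm as well makes the `L¹` norms of the terms summable, which justifies
  -- exchanging sum and integral over `D`.
  obtain ⟨-, h3⟩ := unfolding ker_toPermHom_le_stabInfty hD hS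
    (g := fun τ => ‖peterssonIntegrand k F f τ‖) (fun l hl τ => congrArg _ (hg l hl τ)) hint.norm
  simp only [hterm] at h1 h2 h3
  have hsum : ∀ τ, HasSum
      (fun q => peterssonIntegrand k F (poincareTerm k v ρ (stabInfty Γ) f q) τ)
      (peterssonIntegrand k F (poincareSeries k v ρ (stabInfty Γ) f) τ) := by
    intro τ
    have h := (summable_poincareTerm (Γ := Γ) (ρ := ρ) hk hv hρ hf τ).hasSum
    refine HasSum.mul_right _ ?_
    -- The Poincaré series sits in the conjugate-linear slot; additivity and continuity suffice to
    -- pass to the sum.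
    exact h.map (AddMonoidHom.mk' (fun x => inner ℂ x (F τ)) fun x y => inner_add_left x y _)
      (continuous_id.inner continuous_const)
  refine ⟨integrable_of_hasSum h1 h3.summable hsum
    (continuous_peterssonIntegrand (continuous_of_mem_vvForms hF) hcont).aestronglyMeasurable, ?_⟩
  have h4 := hasSum_integral_of_summable_integral_norm h1 h3.summable
  simp only [(hsum _).tsum_eq] at h4
  exact h4.unique h2

end Unfolding

end VVPoincare

end

/-! ### The main theorem. -/

theorem proposition5p2
    (p : ℕ) (k : ℝ) (hk : 2 < k)
    (v : SL(2, ℤ) → ℂ) (hv : VVPoincare.IsMultiplierSystem k v)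
    (κ : ℝ) (hκ : κ ∈ Set.Ico (0 : ℝ) 1)
    (hvT : v ModularGroup.T = Complex.exp (2 * Real.pi * Complex.I * κ))
    (Γ : Subgroup SL(2, ℤ)) (hfin : Γ.FiniteIndex) (hneg : -1 ∈ Γ)
    (ρ : Γ →* GL (Fin p) ℂ)
    (hρ : VVPoincare.IsUnitaryRep ρ) (hnormal : VVPoincare.IsNormalRep κ ρ)
    (M : ℕ) (hM : 0 < M)
    (hstab : (VVPoincare.stabInfty Γ).map Γ.subtype =
      Subgroup.closure {ModularGroup.T ^ M, -(ModularGroup.T ^ M)})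
    (hTM : ModularGroup.T ^ M ∈ Γ)
    (U : Matrix.unitaryGroup (Fin p) ℂ) (m : Fin p → ℚ) (hm : ∀ i, 0 < m i ∧ m i ≤ 1)
    (hU : (ρ ⟨ModularGroup.T ^ M, hTM⟩).val =
      Complex.exp (-(2 * Real.pi * Complex.I * κ * M)) •
        ((U⁻¹).val *
          Matrix.diagonal (fun i => Complex.exp (2 * Real.pi * Complex.I * (m i : ℂ))) * U.val))
    (ν : ℕ) (j : Fin p) :
    -- the terms of the series do not depend on the choice of coset representatives
    (∀ γ ∈ VVPoincare.stabInfty Γ,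
      VVPoincare.slashRep k v ρ (VVPoincare.expVector M m U ν j) γ =
        VVPoincare.expVector M m U ν j) ∧
    -- absolute and uniform convergence on compact sets
    (∀ K : Set ℍ, IsCompact K →
      HasSumUniformlyOn
        (fun q τ => ‖VVPoincare.poincareTerm k v ρ (VVPoincare.stabInfty Γ)
          (VVPoincare.expVector M m U ν j) q τ‖)
        (fun τ => ∑' q, ‖VVPoincare.poincareTerm k v ρ (VVPoincare.stabInfty Γ)
          (VVPoincare.expVector M m U ν j) q τ‖) K ∧
      HasSumUniformlyOn
        (VVPoincare.poincareTerm k v ρ (VVPoincare.stabInfty Γ)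
          (VVPoincare.expVector M m U ν j))
        (VVPoincare.classicalPoincare k v ρ M m U ν j) K) ∧
    -- the series is a cuspidal vector-valued modular form
    VVPoincare.classicalPoincare k v ρ M m U ν j ∈ VVPoincare.vvCuspForms k v ρ ∧
    -- the Petersson inner product, an integral over any fundamental domain (and there are such)
    (∃ D : Set ℍ, VVPoincare.IsFundDomain Γ D) ∧
    ∀ F ∈ VVPoincare.vvCuspForms k v ρ,
      (∃ b : ℕ → ℂ, VVPoincare.IsFourierExpansion M m U j F b) ∧
      ∀ b : ℕ → ℂ, VVPoincare.IsFourierExpansion M m U j F b →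
        ∀ D : Set ℍ, VVPoincare.IsFundDomain Γ D →
          MeasureTheory.IntegrableOn
            (VVPoincare.peterssonIntegrand k F (VVPoincare.classicalPoincare k v ρ M m U ν j)) D ∧
          VVPoincare.petersson k D F (VVPoincare.classicalPoincare k v ρ M m U ν j) =
            b ν * (((M : ℝ) ^ k * Real.Gamma (k - 1) /
              (4 * Real.pi * ((ν : ℝ) + (m j : ℝ))) ^ (k - 1) : ℝ) : ℂ) := by
  have hmj := (hm j).1
  have hinv : ∀ γ ∈ VVPoincare.stabInfty Γ,
      VVPoincare.slashRep k v ρ (VVPoincare.expVector M m U ν j) γ =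
        VVPoincare.expVector M m U ν j := fun γ hγ =>
    VVPoincare.slashRep_eq_self_of_mem_stabInfty hv hneg (hnormal.1 hneg) hstab hTM
      (VVPoincare.slashRep_expVector_T_pow hv hvT hM hTM hU ν j) hγ
  have hle := VVPoincare.norm_expVector_le_one (U := U) hM hmj ν
  have hcusp := VVPoincare.poincareSeries_mem_vvCuspForms hk hv hvT hfin hρ hnormal hle
    (VVPoincare.norm_expVector_mul_im_rpow_le (by linarith) hM hmj ν)
    (VVPoincare.mdifferentiable_expVector ν) hinv
  refine ⟨hinv, fun K hK => VVPoincare.hasSumUniformlyOn_poincareTerm hk hv hρ hle hK, hcusp,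
    VVPoincare.exists_isFundDomain hneg, fun F hF =>
    ⟨VVPoincare.exists_isFourierExpansion hv hvT hM hTM (hm j).2 hU hF, fun b hb D hD => ?_⟩⟩
  obtain ⟨C, hC⟩ := VVPoincare.exists_bound_of_mem_vvCuspForms (by linarith) hv hfin hρ hF
  have hcont := VVPoincare.continuous_of_mem_vvForms hF.1
  obtain ⟨h1, h2⟩ := VVPoincare.petersson_poincareSeries hk hv hρ hle hinv
    (VVPoincare.continuous_of_mem_vvForms hcusp.1) hF.1 hD
    (VVPoincare.isFundamentalDomain_strip hM hstab hTM)
    (VVPoincare.integrableOn_strip_peterssonIntegrand_expVector hk hM hmj hcont hC ν)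
  exact ⟨h1, h2.trans
    (VVPoincare.integral_strip_peterssonIntegrand_expVector hk hM hmj hcont hC hb ν)⟩
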